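/- Let $T>0$ and consider the Riccati equation \[ x' = a_2(t)x^2 + a_1(t)x + a_0(t), \qquad (R) \] where $a_0,a_1,a_2:\mathbb R\to\mathbb R$ are smooth ($C^\infty$) and $T$-periodic, and $a_2(t)\neq 0$ for all $t\in\mathbb R$. Define the $T$-periodic function \[ \gamma(t) = a_2(t)a_0(t) - A(t)^2 + A'(t), \qquad A(t)=\frac12\Big(a_1(t)+\frac{a_2'(t)}{a_2(t)}\Big), \] and put $\overline\gamma=\frac1T\int_0^T\gamma(t)\,dt$, $\widehat\gamma=\gamma-\overline\gamma$. Let $\mathcal C^1_T$ be the set of $T$-periodic $C^1$ functions $\mathbb R\to\mathbb R$, and $\mathcal C^1_{T,0}$ the subset of those with zero average. For $p\in\mathcal C^1_T$ and $q\in\mathcal C^1_{T,0}$ let \[ \underline\mu(p) = -\max_{t\in[0,T]}\big\{p(t)^2+\widehat\gamma(t)-p'(t)\big\}, \qquad \overline\mu(q) = \frac{\int_0^T e^{-2\int_0^t q(s)\,ds}\,\big(q(t)^2-\widehat\gamma(t)\big)\,dt}{\int_0^T e^{-2\int_0^t q(s)\,ds}\,dt}. \] Then $\gamma^*:=\max_{p\in\mathcal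 C^1_T}\underline\mu(p)$ and $\min_{q\in\mathcal C^1_{T,0}}\overline\mu(q)$ exist and are equal. Define the discriminant $\Delta_\gamma:=\gamma^*-\overline\gamma$. A limit cycle of (R) is an isolated $T$-periodic solution $\phi$. It is hyperbolic if $\phi(0)$ is a simple zero, and double if $\phi(0)$ is a zero of multiplicity two, of the displacement map $x_0\mapsto x(T;x_0)-x_0$, where $x(\cdot\,;x_0)$ is the solution of (R) with $x(0;x_0)=x_0$. It is semi-stable if it is asymptotically stable from one side and asymptotically stable in backward time from the other side. Then: 1. if $\Delta_\gamma>0$, equation (R) has exactly two $T$-periodic solutions, and both are hyperbolic limit cycles; 2. if $\Delta_\gamma=0$, equation (R) has exactly one $T$-periodic solution, and it is a semi-stable double limit cycle; 3. if $\Delta_\gamma<0$, equation (R) has no $T$-periodic solutions. Moreover, for all $p\in\mathcal C^1_T$ and $q\in\mathcal C^1_{T,0}$, \[ \underline\mu(p)-\overline\gamma \;\le\; \Delta_\gamma \;\le\; \overline\mu(q)-\overline\gamma . \] -/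

import Mathlib

open scoped ContDiff Topology

noncomputable section

namespace PeriodicRiccati

/-! ### Scalar equations `x' = f(t, x)` and their limit cycles -/

/-- `u` solves `x' = f(t, x)` on the set (interval) `s`. -/
def IsSolutionOn (f : ℝ → ℝ → ℝ) (s : Set ℝ) (u : ℝ → ℝ) : Prop :=
  ∀ t ∈ s, HasDerivWithinAt u (f t (u t)) s t

/-- `φ` is a `T`-periodic solution of `x' = f(t, x)`, defined on the whole line. -/
def IsPeriodicSolution (f : ℝ → ℝ → ℝ) (T : ℝ) (φ : ℝ → ℝ) : Prop :=
  IsSolutionOn f Set.univ φ ∧ Function.Periodic φ T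

/-- A limit cycle: an isolated `T`-periodic solution. -/
def IsLimitCycle (f : ℝ → ℝ → ℝ) (T : ℝ) (φ : ℝ → ℝ) : Prop :=
  IsPeriodicSolution f T φ ∧
    ∃ ε > 0, ∀ ψ, IsPeriodicSolution f T ψ → |ψ 0 - φ 0| < ε → ψ = φ

/-- The initial conditions at time `0` whose solution is defined up to time `T`. -/
def poincareDomain (f : ℝ → ℝ → ℝ) (T : ℝ) : Set ℝ :=
  {x | ∃ u, IsSolutionOn f (Set.Icc 0 T) u ∧ u 0 = x}

open Classical in
/-- The Poincaré map at time `T`: it sends `x ∈ poincareDomain f T` to the value at time `T` of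
the solution (unique when `f` is locally Lipschitz in `x`) that starts at `x` at time `0`.
Outside the domain the value is irrelevant and set to `0`. -/
def poincareMap (f : ℝ → ℝ → ℝ) (T x : ℝ) : ℝ :=
  if h : ∃ u, IsSolutionOn f (Set.Icc 0 T) u ∧ u 0 = x then h.choose T else 0

/-- The displacement map: the Poincaré map minus the identity. -/
def displacement (f : ℝ → ℝ → ℝ) (T x : ℝ) : ℝ := poincareMap f T x - x

/-- `x` is a zero of multiplicity exactly `n` of the displacement map, which has to be defined
and of class `C^n` around `x`. -/
def IsZeroOfMultiplicity (f : ℝ → ℝ → ℝ) (T : ℝ) (n : ℕ) (x : ℝ) : Prop :=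
  poincareDomain f T ∈ 𝓝 x ∧ ContDiffAt ℝ n (displacement f T) x ∧
    (∀ k < n, iteratedDeriv k (displacement f T) x = 0) ∧
    iteratedDeriv n (displacement f T) x ≠ 0

/-- A hyperbolic limit cycle: the corresponding zero of the displacement map is simple. -/
def IsHyperbolicLimitCycle (f : ℝ → ℝ → ℝ) (T : ℝ) (φ : ℝ → ℝ) : Prop :=
  IsLimitCycle f T φ ∧ IsZeroOfMultiplicity f T 1 (φ 0)

/-- A double limit cycle: the corresponding zero of the displacement map has multiplicity two. -/
def IsDoubleLimitCycle (f : ℝ → ℝ → ℝ) (T : ℝ) (φ : ℝ → ℝ) : Prop :=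
  IsLimitCycle f T φ ∧ IsZeroOfMultiplicity f T 2 (φ 0)

/-- The solution `φ` is asymptotically stable (in forward time) from above if `σ = 1`, and from
below if `σ = -1`. -/
def AttractsFromSide (f : ℝ → ℝ → ℝ) (σ : ℝ) (φ : ℝ → ℝ) : Prop :=
  ∀ ε > 0, ∃ δ > 0, ∀ x, 0 < σ * (x - φ 0) → σ * (x - φ 0) < δ →
    ∃ u, IsSolutionOn f (Set.Ici 0) u ∧ u 0 = x ∧ (∀ t, 0 ≤ t → |u t - φ t| < ε) ∧
      Filter.Tendsto (fun t => u t - φ t) Filter.atTop (𝓝 0)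

/-- The solution `φ` is asymptotically stable in backward time from above if `σ = 1`, and from
below if `σ = -1`. -/
def RepelsFromSide (f : ℝ → ℝ → ℝ) (σ : ℝ) (φ : ℝ → ℝ) : Prop :=
  ∀ ε > 0, ∃ δ > 0, ∀ x, 0 < σ * (x - φ 0) → σ * (x - φ 0) < δ →
    ∃ u, IsSolutionOn f (Set.Iic 0) u ∧ u 0 = x ∧ (∀ t, t ≤ 0 → |u t - φ t| < ε) ∧
      Filter.Tendsto (fun t => u t - φ t) Filter.atBot (𝓝 0)

/-- Semi-stability: `φ` attracts from one side and repels from the other. -/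
def IsSemiStable (f : ℝ → ℝ → ℝ) (φ : ℝ → ℝ) : Prop :=
  (AttractsFromSide f 1 φ ∧ RepelsFromSide f (-1) φ) ∨
    (AttractsFromSide f (-1) φ ∧ RepelsFromSide f 1 φ)

/-! ### The discriminant of `x' = x ^ 2 + γ(t)` -/

/-- The average of a `T`-periodic function. -/
def average (T : ℝ) (γ : ℝ → ℝ) : ℝ := 1 / T * ∫ t in (0 : ℝ)..T, γ t

/-- The mean-centered function of `γ`. -/
def centered (T : ℝ) (γ : ℝ → ℝ) (t : ℝ) : ℝ := γ t - average T γ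

/-- The `T`-periodic functions of class `C^1`. -/
def C1T (T : ℝ) : Set (ℝ → ℝ) := {p | ContDiff ℝ 1 p ∧ Function.Periodic p T}

/-- The `T`-periodic functions of class `C^1` with zero average. -/
def C1T0 (T : ℝ) : Set (ℝ → ℝ) := {p | p ∈ C1T T ∧ average T p = 0}

/-- The lower functional `-max_{t ∈ [0, T]} (p(t)^2 + γ̂(t) - p'(t))`. -/
def muLower (T : ℝ) (γ p : ℝ → ℝ) : ℝ :=
  -sSup ((fun t => p t ^ 2 + centered T γ t - deriv p t) '' Set.Icc 0 T)

/-- The weight `exp (-2 ∫_0^t p)`. -/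
def weight (p : ℝ → ℝ) (t : ℝ) : ℝ := Real.exp (-2 * ∫ s in (0 : ℝ)..t, p s)

/-- The upper functional: the mean of `p^2 - γ̂` over `[0, T]` with weight `exp (-2 ∫_0^t p)`. -/
def muUpper (T : ℝ) (γ p : ℝ → ℝ) : ℝ :=
  (∫ t in (0 : ℝ)..T, weight p t)⁻¹ *
    ∫ t in (0 : ℝ)..T, weight p t * (p t ^ 2 - centered T γ t)

/-- The number `γ^*`, the maximum of the lower functional over all `C^1` periodic functions. -/
def gammaStar (T : ℝ) (γ : ℝ → ℝ) : ℝ := sSup (muLower T γ '' C1T T)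

/-- The discriminant `Δ_γ = γ^* - average of γ`. -/
def discriminant (T : ℝ) (γ : ℝ → ℝ) : ℝ := gammaStar T γ - average T γ

/-! ### General Riccati equations -/

/-- The right-hand side `a₂(t) x^2 + a₁(t) x + a₀(t)`. -/
def riccati (a₂ a₁ a₀ : ℝ → ℝ) (t x : ℝ) : ℝ := a₂ t * x ^ 2 + a₁ t * x + a₀ t

/-- `A = (a₁ + a₂' / a₂) / 2`. -/
def shift (a₂ a₁ : ℝ → ℝ) (t : ℝ) : ℝ := 1 / 2 * (a₁ t + deriv a₂ t / a₂ t)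

/-- `γ = a₂ a₀ - A^2 + A'`. -/
def reducedGamma (a₂ a₁ a₀ : ℝ → ℝ) (t : ℝ) : ℝ :=
  a₂ t * a₀ t - shift a₂ a₁ t ^ 2 + deriv (shift a₂ a₁) t

end PeriodicRiccati

end

noncomputable section

namespace PeriodicRiccati

open Set

/-! ### The flow of a Riccati equation around a known solution -/

/-! Around a known solution `x`, the difference of solutions obeys a Bernoulli equation, so the flow
is explicit: with initial offset `h`, multiplier `m` and `c = variationIntegral ... T`, the offset
at time `T` is `h * m / (1 - h * c)`. Since `a₂` has constant sign, `c ≠ 0`. The fixed points are `h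
= 0` and `h * c = 1 - m`: two simple ones if `m ≠ 1`, one double if `m = 1`. Everything thus follows
from one periodic solution and its multiplier.

The substitution `y = a₂ x + A` gives `y' = y ^ 2 + γ`, whose periodic solutions have multiplier `1`
exactly when their mean is zero. In the family `y' = y ^ 2 + γ̂ + lam`, truncation and compactness
yield a largest `lam` with a periodic solution. There a solution of zero mean exists
(`exists_zero_mean_periodic`): otherwise the midpoint of two periodic solutions would be a strict
upper solution for a larger parameter.

That zero-mean solution attains both extrema: `muLower_le` compares any `p` with it by Rolle, and
`weighted_identity` writes `muUpper q - lam` as a weighted mean square. Hence `lam = γ^*`, and the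
sign of `γ^*` minus the average of `γ` decides the case. -/

/-- The solution with value `1` at `0` of the variational equation of the Riccati equation
along `x`. -/
def variation (a₂ a₁ x : ℝ → ℝ) (t : ℝ) : ℝ :=
  Real.exp (∫ s in (0 : ℝ)..t, (2 * a₂ s * x s + a₁ s))

/-- The primitive of `a₂` times the variation along `x`. -/
def variationIntegral (a₂ a₁ x : ℝ → ℝ) (t : ℝ) : ℝ :=
  ∫ s in (0 : ℝ)..t, a₂ s * variation a₂ a₁ x s

theorem IsPeriodicSolution.hasDerivAt {f : ℝ → ℝ → ℝ} {T : ℝ} {φ : ℝ → ℝ}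
    (h : IsPeriodicSolution f T φ) (t : ℝ) : HasDerivAt φ (f t (φ t)) t :=
  (h.1 t (mem_univ t)).hasDerivAt Filter.univ_mem

theorem IsPeriodicSolution.continuous {f : ℝ → ℝ → ℝ} {T : ℝ} {φ : ℝ → ℝ}
    (h : IsPeriodicSolution f T φ) : Continuous φ :=
  continuous_iff_continuousAt.2 fun t => (h.hasDerivAt t).continuousAt

theorem hasDerivAt_primitive {k : ℝ → ℝ} (hk : Continuous k) (t : ℝ) :
    HasDerivAt (fun t => ∫ s in (0 : ℝ)..t, k s) (k t) t :=
  intervalIntegral.integral_hasDerivAt_right (hk.intervalIntegrable _ _)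
    (hk.stronglyMeasurableAtFilter _ _) hk.continuousAt

theorem eq_zero_of_linear_ode {k d : ℝ → ℝ} {T : ℝ} (hk : ContinuousOn k (Icc 0 T))
    (hd : ∀ t ∈ Icc 0 T, HasDerivWithinAt d (k t * d t) (Icc 0 T) t) (h0 : d 0 = 0) :
    ∀ t ∈ Icc 0 T, d t = 0 := by
  obtain ⟨K, hK⟩ := isCompact_Icc.exists_bound_of_continuousOn hk
  refine eq_zero_of_abs_deriv_le_mul_abs_self_of_eq_zero_right (f' := fun t => k t * d t) (K := K)
    (fun t ht => (hd t ht).continuousWithinAt) (fun t ht => ?_) h0 (fun t ht => ?_)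
  · exact (hd t (Ico_subset_Icc_self ht)).mono_of_mem_nhdsWithin (Icc_mem_nhdsGE_of_mem ht)
  · rw [norm_mul]
    exact mul_le_mul_of_nonneg_right (hK t (Ico_subset_Icc_self ht)) (norm_nonneg _)

section Flow

variable {a₂ a₁ a₀ x : ℝ → ℝ}

theorem variation_pos (a₂ a₁ x : ℝ → ℝ) (t : ℝ) : 0 < variation a₂ a₁ x t := Real.exp_pos _

theorem variation_zero (a₂ a₁ x : ℝ → ℝ) : variation a₂ a₁ x 0 = 1 := by simp [variation]

theorem variationIntegral_zero (a₂ a₁ x : ℝ → ℝ) : variationIntegral a₂ a₁ x 0 = 0 := by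
  simp [variationIntegral]

theorem hasDerivAt_variation (h₂ : Continuous a₂) (h₁ : Continuous a₁) (hx : Continuous x)
    (t : ℝ) : HasDerivAt (variation a₂ a₁ x)
      ((2 * a₂ t * x t + a₁ t) * variation a₂ a₁ x t) t := by
  have := (hasDerivAt_primitive (k := fun s => 2 * a₂ s * x s + a₁ s) (by fun_prop) t).exp
  rw [mul_comm]
  exact this

theorem continuous_variation (h₂ : Continuous a₂) (h₁ : Continuous a₁) (hx : Continuous x) :
    Continuous (variation a₂ a₁ x) :=
  continuous_iff_continuousAt.2 fun t => (hasDerivAt_variation h₂ h₁ hx t).continuousAt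

theorem hasDerivAt_variationIntegral (h₂ : Continuous a₂) (h₁ : Continuous a₁)
    (hx : Continuous x) (t : ℝ) :
    HasDerivAt (variationIntegral a₂ a₁ x) (a₂ t * variation a₂ a₁ x t) t :=
  hasDerivAt_primitive (h₂.mul (continuous_variation h₂ h₁ hx)) t

theorem continuous_variationIntegral (h₂ : Continuous a₂) (h₁ : Continuous a₁)
    (hx : Continuous x) : Continuous (variationIntegral a₂ a₁ x) :=
  continuous_iff_continuousAt.2 fun t => (hasDerivAt_variationIntegral h₂ h₁ hx t).continuousAt

/-- The solutions of a Riccati equation in terms of a known solution `x`. -/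
theorem hasDerivAt_riccati_perturbation (h₂ : Continuous a₂) (h₁ : Continuous a₁)
    (hx : ∀ t, HasDerivAt x (riccati a₂ a₁ a₀ t (x t)) t) (h t : ℝ)
    (hne : 1 - h * variationIntegral a₂ a₁ x t ≠ 0) :
    HasDerivAt (fun t => x t + h * variation a₂ a₁ x t / (1 - h * variationIntegral a₂ a₁ x t))
      (riccati a₂ a₁ a₀ t
        (x t + h * variation a₂ a₁ x t / (1 - h * variationIntegral a₂ a₁ x t))) t := by
  have hxc : Continuous x := continuous_iff_continuousAt.2 fun t => (hx t).continuousAt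
  have hL := (hasDerivAt_variation h₂ h₁ hxc t).const_mul h
  have hG := ((hasDerivAt_variationIntegral h₂ h₁ hxc t).const_mul h).const_sub 1
  refine ((hx t).add (hL.div hG hne)).congr_deriv ?_
  simp only [riccati]
  field_simp
  ring

/-- The explicit formula with its denominator cleared holds for every solution, with no prior
control of zeros of the denominator. The defect `d` satisfies `d' = k d` and vanishes at `0`, so
Grönwall gives `d = 0`. -/
theorem riccati_solution_relation (h₂ : Continuous a₂) (h₁ : Continuous a₁)
    (hx : ∀ t, HasDerivAt x (riccati a₂ a₁ a₀ t (x t)) t) {T : ℝ} {u : ℝ → ℝ}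
    (hu : IsSolutionOn (riccati a₂ a₁ a₀) (Icc 0 T) u) {t : ℝ} (ht : t ∈ Icc 0 T) :
    (u t - x t) * (1 - (u 0 - x 0) * variationIntegral a₂ a₁ x t)
      = (u 0 - x 0) * variation a₂ a₁ x t := by
  have hxc : Continuous x := continuous_iff_continuousAt.2 fun t => (hx t).continuousAt
  have huc : ContinuousOn u (Icc 0 T) := fun t ht => (hu t ht).continuousWithinAt
  set h := u 0 - x 0
  have key := eq_zero_of_linear_ode (T := T)
    (k := fun t => a₂ t * (u t - x t) + (2 * a₂ t * x t + a₁ t))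
    (d := fun t => (u t - x t) * (1 - h * variationIntegral a₂ a₁ x t)
      - h * variation a₂ a₁ x t) (by fun_prop) (fun t ht => ?_)
    (by simp [variation_zero, variationIntegral_zero, h]) t ht
  · exact sub_eq_zero.1 key
  · have hL := ((hasDerivAt_variation h₂ h₁ hxc t).const_mul h).hasDerivWithinAt (s := Icc 0 T)
    have hG := (((hasDerivAt_variationIntegral h₂ h₁ hxc t).const_mul h).const_sub
      1).hasDerivWithinAt (s := Icc 0 T)
    refine ((((hu t ht).sub (hx t).hasDerivWithinAt).mul hG).sub hL).congr_deriv ?_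
    simp only [riccati, Pi.sub_apply]
    ring

/-- A continuous function without zeros has constant sign. -/
theorem exists_sign {a : ℝ → ℝ} (ha : Continuous a) (hne : ∀ t, a t ≠ 0) :
    ∃ σ : ℝ, (σ = 1 ∨ σ = -1) ∧ ∀ t, 0 < σ * a t := by
  rcases lt_or_gt_of_ne (hne 0) with h | h
  · refine ⟨-1, Or.inr rfl, fun t => ?_⟩
    by_contra! hc
    obtain ⟨s, -, hs⟩ := isPreconnected_univ.intermediate_value (mem_univ (0 : ℝ)) (mem_univ t)
      ha.continuousOn (show (0 : ℝ) ∈ Icc (a 0) (a t) from ⟨h.le, by linarith⟩)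
    exact hne s hs
  · refine ⟨1, Or.inl rfl, fun t => ?_⟩
    by_contra! hc
    obtain ⟨s, -, hs⟩ := isPreconnected_univ.intermediate_value (mem_univ t) (mem_univ (0 : ℝ))
      ha.continuousOn (show (0 : ℝ) ∈ Icc (a t) (a 0) from ⟨by linarith, h.le⟩)
    exact hne s hs

theorem variationIntegral_ne_zero (h₂ : Continuous a₂) (h₁ : Continuous a₁) (hx : Continuous x)
    (hne : ∀ t, a₂ t ≠ 0) {T : ℝ} (hT : 0 < T) : variationIntegral a₂ a₁ x T ≠ 0 := by
  obtain ⟨σ, -, hσ⟩ := exists_sign h₂ hne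
  have hc := continuous_variation h₂ h₁ hx
  have : 0 < ∫ s in (0 : ℝ)..T, σ * (a₂ s * variation a₂ a₁ x s) := by
    refine intervalIntegral.intervalIntegral_pos_of_pos
      (Continuous.intervalIntegrable (by fun_prop) _ _) (fun s => ?_) hT
    rw [← mul_assoc]
    exact mul_pos (hσ s) (variation_pos ..)
  intro h0
  rw [intervalIntegral.integral_const_mul] at this
  rw [variationIntegral] at h0
  simp [h0] at this

theorem exists_pos_forall_one_sub_mul_pos {G : ℝ → ℝ} (hG : Continuous G) (T : ℝ) :
    ∃ δ > 0, ∀ h, |h| < δ → ∀ t ∈ Icc 0 T, 0 < 1 - h * G t := by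
  obtain ⟨B, hB⟩ := isCompact_Icc.exists_bound_of_continuousOn (hG.continuousOn (s := Icc 0 T))
  refine ⟨1 / (|B| + 1), by positivity, fun h hh t ht => ?_⟩
  have h1 : |h| * (|B| + 1) < 1 := by rwa [lt_div_iff₀ (by positivity)] at hh
  have h2 : |h * G t| ≤ |h| * (|B| + 1) := by
    rw [abs_mul]
    gcongr
    have := hB t ht
    rw [Real.norm_eq_abs] at this
    linarith [le_abs_self B]
  linarith [le_abs_self (h * G t)]

/-- `poincareMap` uses a chosen solution; the relation fixes its value at `T` whichever one was
chosen. -/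
theorem poincareMap_riccati (h₂ : Continuous a₂) (h₁ : Continuous a₁)
    (hx : ∀ t, HasDerivAt x (riccati a₂ a₁ a₀ t (x t)) t) {T : ℝ} (hT : 0 < T) :
    ∀ᶠ y in 𝓝 (x 0), y ∈ poincareDomain (riccati a₂ a₁ a₀) T ∧
      displacement (riccati a₂ a₁ a₀) T y =
        x T + (y - x 0) * variation a₂ a₁ x T / (1 - (y - x 0) * variationIntegral a₂ a₁ x T)
          - y := by
  have hxc : Continuous x := continuous_iff_continuousAt.2 fun t => (hx t).continuousAt
  obtain ⟨δ, hδ, H⟩ := exists_pos_forall_one_sub_mul_pos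
    (continuous_variationIntegral h₂ h₁ hxc) T
  filter_upwards [Metric.ball_mem_nhds (x 0) hδ] with y hy
  have H' := H (y - x 0) (by simpa [Real.dist_eq] using hy)
  have hdom : ∃ u, IsSolutionOn (riccati a₂ a₁ a₀) (Icc 0 T) u ∧ u 0 = y :=
    ⟨_, fun t ht => (hasDerivAt_riccati_perturbation h₂ h₁ hx (y - x 0) t
      (H' t ht).ne').hasDerivWithinAt, by simp [variation_zero, variationIntegral_zero]⟩
  refine ⟨hdom, ?_⟩
  have hT' : T ∈ Icc 0 T := ⟨hT.le, le_rfl⟩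
  have hrel := riccati_solution_relation h₂ h₁ hx hdom.choose_spec.1 hT'
  rw [hdom.choose_spec.2] at hrel
  rw [displacement, poincareMap, dif_pos hdom, ← hrel, mul_div_cancel_right₀ _ (H' T hT').ne']
  ring

end Flow

/-- The jet at `h = 0` of a Möbius displacement. -/
theorem moebius_displacement_jet (m c x₀ : ℝ) :
    let D : ℝ → ℝ := fun y => x₀ + (y - x₀) * m / (1 - (y - x₀) * c) - y
    ContDiffAt ℝ 2 D x₀ ∧ iteratedDeriv 0 D x₀ = 0 ∧ iteratedDeriv 1 D x₀ = m - 1 ∧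
      iteratedDeriv 2 D x₀ = 2 * m * c := by
  intro D
  have hne : ∀ᶠ y in 𝓝 x₀, 1 - (y - x₀) * c ≠ 0 :=
    ContinuousAt.eventually_ne (by fun_prop) (by simp)
  have hd : ∀ y, 1 - (y - x₀) * c ≠ 0 →
      HasDerivAt D (m / (1 - (y - x₀) * c) ^ 2 - 1) y := by
    intro y hy
    have h1 := ((hasDerivAt_id y).sub_const x₀).mul_const m
    have h2 := (((hasDerivAt_id y).sub_const x₀).mul_const c).const_sub 1
    refine (((h1.div h2 hy).const_add x₀).sub (hasDerivAt_id y)).congr_deriv ?_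
    simp only [id]
    field_simp
    ring
  have hderiv : deriv D =ᶠ[𝓝 x₀] fun y => m / (1 - (y - x₀) * c) ^ 2 - 1 := by
    filter_upwards [hne] with y hy using (hd y hy).deriv
  refine ⟨?_, by simp [D], ?_, ?_⟩
  · refine ((contDiffAt_const.add (ContDiffAt.div ?_ ?_ (by simp))).sub contDiffAt_id)
    · fun_prop
    · fun_prop
  · rw [iteratedDeriv_one, hderiv.eq_of_nhds]
    simp
  · rw [iteratedDeriv_succ, iteratedDeriv_one, hderiv.deriv_eq]
    have h2 := (((hasDerivAt_id x₀).sub_const x₀).mul_const c).const_sub 1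
    have := (((hasDerivAt_const x₀ m).div (h2.pow 2) (by simp)).sub_const 1).deriv
    simp at this
    simp
    linarith

/-! ### Periodic solutions of a Riccati equation with one known periodic solution -/

theorem eq_of_periodic_of_eqOn {u v : ℝ → ℝ} {T : ℝ} (hT : 0 < T) (hu : Function.Periodic u T)
    (hv : Function.Periodic v T) (h : ∀ t ∈ Ico 0 T, u t = v t) : u = v := by
  funext t
  obtain ⟨s, hs, hts⟩ := (hu.sub hv).exists_mem_Ico₀ hT t
  have := h s hs
  simp only [Pi.sub_apply] at hts
  linarith

theorem periodic_primitive {k : ℝ → ℝ} {T : ℝ} (hk : Continuous k) (hp : Function.Periodic k T)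
    (h0 : ∫ s in (0 : ℝ)..T, k s = 0) : Function.Periodic (fun t => ∫ s in (0 : ℝ)..t, k s) T := by
  intro t
  have h1 := hp.intervalIntegral_add_eq t 0
  rw [zero_add, h0] at h1
  have := intervalIntegral.integral_add_adjacent_intervals (hk.intervalIntegrable 0 t)
    (hk.intervalIntegrable (μ := MeasureTheory.volume) t (t + T))
  simp only
  linarith

/-- Gluing copies of `u` leaves only one-sided derivatives at multiples of `T`. The continuous
extension through the circle avoids this: it equals `u 0` plus the primitive of a continuous
function, hence is differentiable everywhere. -/
theorem exists_periodic_extension {f : ℝ → ℝ → ℝ} {T : ℝ} (hT : 0 < T)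
    (hf : Continuous (Function.uncurry f)) (hp : ∀ t y, f (t + T) y = f t y) {u : ℝ → ℝ}
    (hu : IsSolutionOn f (Icc 0 T) u) (h0 : u 0 = u T) :
    ∃ φ, IsPeriodicSolution f T φ ∧ ∀ t ∈ Ico 0 T, φ t = u t := by
  have huc : ContinuousOn u (Icc 0 T) := fun t ht => (hu t ht).continuousWithinAt
  have : Fact (0 < T) := ⟨hT⟩
  set v : ℝ → ℝ := fun t => AddCircle.liftIco T 0 u (t : AddCircle T)
  have hvc : Continuous v := (AddCircle.liftIco_zero_continuous h0 huc).comp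
    (AddCircle.continuous_mk' T)
  have hvp : Function.Periodic v T := fun t => by simp [v]
  have hvu : ∀ t ∈ Ico 0 T, v t = u t := fun t ht => AddCircle.liftIco_zero_coe_apply ht
  set k : ℝ → ℝ := fun t => f t (v t)
  have hk : Continuous k := hf.comp (continuous_id.prodMk hvc)
  have hkp : Function.Periodic k T := fun t => by simp only [k, hvp t, hp]
  have hint : ∀ t ∈ Icc 0 T, ∫ s in (0 : ℝ)..t, k s = u t - u 0 := by
    intro t ht
    refine intervalIntegral.integral_eq_sub_of_hasDerivAt_of_le ht.1
      (huc.mono (Icc_subset_Icc_right ht.2)) (fun s hs => ?_) (hk.intervalIntegrable _ _)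
    have hs' : s ∈ Ioo 0 T := ⟨hs.1, hs.2.trans_le ht.2⟩
    simp only [k, hvu s (Ioo_subset_Ico_self hs')]
    exact (hu s (Ioo_subset_Icc_self hs')).hasDerivAt (Icc_mem_nhds hs'.1 hs'.2)
  have hkper := periodic_primitive hk hkp (by rw [hint T ⟨hT.le, le_rfl⟩, h0, sub_self])
  have hφv : (fun t => u 0 + ∫ s in (0 : ℝ)..t, k s) = v := by
    refine eq_of_periodic_of_eqOn hT (fun t => ?_) hvp fun t ht => ?_
    · have := hkper t
      simp only at this ⊢
      rw [this]
    · rw [hint t (Ico_subset_Icc_self ht), hvu t ht]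
      ring
  refine ⟨v, ⟨fun t _ => ?_, hvp⟩, hvu⟩
  have := (hasDerivAt_primitive hk t).const_add (u 0)
  rw [hφv] at this
  exact this.hasDerivWithinAt

section Periodic

variable {a₂ a₁ a₀ x : ℝ → ℝ} {T : ℝ}

theorem IsPeriodicSolution.ext_riccati (h₂ : Continuous a₂) (h₁ : Continuous a₁) (hT : 0 < T)
    {ψ : ℝ → ℝ} (hx : IsPeriodicSolution (riccati a₂ a₁ a₀) T x)
    (hψ : IsPeriodicSolution (riccati a₂ a₁ a₀) T ψ) (h : ψ 0 = x 0) : ψ = x := by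
  refine eq_of_periodic_of_eqOn hT hψ.2 hx.2 fun t ht => ?_
  have := riccati_solution_relation h₂ h₁ hx.hasDerivAt (T := T) (u := ψ)
    (fun t _ => (hψ.hasDerivAt t).hasDerivWithinAt) (Ico_subset_Icc_self ht)
  simp [h] at this
  linarith

theorem IsPeriodicSolution.initial_relation (h₂ : Continuous a₂) (h₁ : Continuous a₁)
    (hT : 0 < T) {ψ : ℝ → ℝ} (hx : IsPeriodicSolution (riccati a₂ a₁ a₀) T x)
    (hψ : IsPeriodicSolution (riccati a₂ a₁ a₀) T ψ) :
    ψ 0 = x 0 ∨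
      (ψ 0 - x 0) * variationIntegral a₂ a₁ x T = 1 - variation a₂ a₁ x T := by
  have := riccati_solution_relation h₂ h₁ hx.hasDerivAt (T := T) (u := ψ)
    (fun t _ => (hψ.hasDerivAt t).hasDerivWithinAt) (t := T) ⟨hT.le, le_rfl⟩
  rw [hψ.2.eq, hx.2.eq] at this
  by_cases h : ψ 0 - x 0 = 0
  · exact Or.inl (sub_eq_zero.1 h)
  · right
    have := mul_left_cancel₀ h this
    linarith

/-- `1 - h * g` is affine in `g`, equal to `1` at `g = 0` and positive at `g = G`; `σ` only records
on which side of `0` the segment lies. -/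
theorem one_sub_mul_pos_of_endpoint {h g G σ : ℝ} (hσ : σ = 1 ∨ σ = -1) (h1 : 0 ≤ σ * g)
    (h2 : σ * g ≤ σ * G) (h3 : 0 < 1 - h * G) : 0 < 1 - h * g := by
  rcases hσ with rfl | rfl <;> rcases le_total 0 h with hh | hh <;> nlinarith

theorem variationIntegral_mul_sign_mono (h₂ : Continuous a₂) (h₁ : Continuous a₁) (hx : Continuous x)
    {σ : ℝ} (hσ : ∀ t, 0 < σ * a₂ t) {s t : ℝ} (hst : s ≤ t) :
    σ * variationIntegral a₂ a₁ x s ≤ σ * variationIntegral a₂ a₁ x t := by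
  refine monotone_of_hasDerivAt_nonneg
    (fun t => (hasDerivAt_variationIntegral h₂ h₁ hx t).const_mul σ) (fun t => ?_) hst
  have := mul_pos (hσ t) (variation_pos a₂ a₁ x t)
  simp only [Pi.zero_apply]
  linarith

theorem continuous_uncurry_riccati (h₂ : Continuous a₂) (h₁ : Continuous a₁)
    (h₀ : Continuous a₀) : Continuous (Function.uncurry (riccati a₂ a₁ a₀)) := by
  simp only [Function.uncurry_def, riccati]
  fun_prop

/-- For the other fixed point `h` of the Möbius map, the denominator is `1` at time `0` and `m > 0`
at time `T`; being monotone, it stays positive and there is no blow-up. If `m = 1` the solution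
found is `x` itself. -/
theorem exists_second_periodic (h₂ : Continuous a₂) (h₁ : Continuous a₁) (h₀ : Continuous a₀)
    (hp₂ : Function.Periodic a₂ T) (hp₁ : Function.Periodic a₁ T) (hp₀ : Function.Periodic a₀ T)
    (hne : ∀ t, a₂ t ≠ 0) (hT : 0 < T) (hx : IsPeriodicSolution (riccati a₂ a₁ a₀) T x) :
    ∃ ψ, IsPeriodicSolution (riccati a₂ a₁ a₀) T ψ ∧
      (ψ 0 - x 0) * variationIntegral a₂ a₁ x T = 1 - variation a₂ a₁ x T := by
  have hc := variationIntegral_ne_zero h₂ h₁ hx.continuous hne hT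
  obtain ⟨σ, hσ, hpos⟩ := exists_sign h₂ hne
  set h := (1 - variation a₂ a₁ x T) / variationIntegral a₂ a₁ x T with hh
  have hh' : h * variationIntegral a₂ a₁ x T = 1 - variation a₂ a₁ x T := div_mul_cancel₀ _ hc
  have hm := variation_pos a₂ a₁ x T
  have H : ∀ t ∈ Icc 0 T, 0 < 1 - h * variationIntegral a₂ a₁ x t := fun t ht => by
    refine one_sub_mul_pos_of_endpoint hσ ?_
      (variationIntegral_mul_sign_mono h₂ h₁ hx.continuous hpos ht.2) (by linarith)
    simpa [variationIntegral_zero] using variationIntegral_mul_sign_mono h₂ h₁ hx.continuous hpos ht.1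
  obtain ⟨ψ, hψ, hψu⟩ := exists_periodic_extension hT (continuous_uncurry_riccati h₂ h₁ h₀)
    (fun t y => by simp only [riccati, hp₂ t, hp₁ t, hp₀ t])
    (fun t ht => (hasDerivAt_riccati_perturbation h₂ h₁ hx.hasDerivAt h t
      (H t ht).ne').hasDerivWithinAt) (by
      rw [hh', hx.2.eq, variation_zero, variationIntegral_zero]
      simp [hm.ne'])
  refine ⟨ψ, hψ, ?_⟩
  rw [hψu 0 ⟨le_rfl, hT⟩]
  simpa [variation_zero, variationIntegral_zero] using hh'

theorem displacement_jet (h₂ : Continuous a₂) (h₁ : Continuous a₁) (hT : 0 < T)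
    (hx : IsPeriodicSolution (riccati a₂ a₁ a₀) T x) :
    poincareDomain (riccati a₂ a₁ a₀) T ∈ 𝓝 (x 0) ∧
      ContDiffAt ℝ 2 (displacement (riccati a₂ a₁ a₀) T) (x 0) ∧
      iteratedDeriv 0 (displacement (riccati a₂ a₁ a₀) T) (x 0) = 0 ∧
      iteratedDeriv 1 (displacement (riccati a₂ a₁ a₀) T) (x 0) = variation a₂ a₁ x T - 1 ∧
      iteratedDeriv 2 (displacement (riccati a₂ a₁ a₀) T) (x 0) =
        2 * variation a₂ a₁ x T * variationIntegral a₂ a₁ x T := by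
  have H := poincareMap_riccati h₂ h₁ hx.hasDerivAt hT
  have hD := H.mono fun y hy => hy.2
  rw [hx.2.eq] at hD
  obtain ⟨j, j0, j1, j2⟩ := moebius_displacement_jet (variation a₂ a₁ x T)
    (variationIntegral a₂ a₁ x T) (x 0)
  exact ⟨H.mono fun y hy => hy.1, j.congr_of_eventuallyEq hD,
    (Filter.EventuallyEq.iteratedDeriv_eq 0 hD).trans j0,
    (Filter.EventuallyEq.iteratedDeriv_eq 1 hD).trans j1,
    (Filter.EventuallyEq.iteratedDeriv_eq 2 hD).trans j2⟩

theorem isHyperbolicLimitCycle_of_variation_ne_one (h₂ : Continuous a₂) (h₁ : Continuous a₁)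
    (hne : ∀ t, a₂ t ≠ 0) (hT : 0 < T) (hx : IsPeriodicSolution (riccati a₂ a₁ a₀) T x)
    (hm : variation a₂ a₁ x T ≠ 1) : IsHyperbolicLimitCycle (riccati a₂ a₁ a₀) T x := by
  have hc := variationIntegral_ne_zero h₂ h₁ hx.continuous hne hT
  -- The isolation radius is the exact distance to the other fixed point.
  refine ⟨⟨hx, |(1 - variation a₂ a₁ x T) / variationIntegral a₂ a₁ x T|,
    abs_pos.2 (div_ne_zero (sub_ne_zero.2 hm.symm) hc), fun ψ hψ hlt => ?_⟩, ?_⟩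
  · refine hx.ext_riccati h₂ h₁ hT hψ ((hx.initial_relation h₂ h₁ hT hψ).resolve_right fun h => ?_)
    rw [← h, mul_div_cancel_right₀ _ hc] at hlt
    exact hlt.false
  · obtain ⟨hdom, hcd, h0, h1, -⟩ := displacement_jet h₂ h₁ hT hx
    refine ⟨hdom, hcd.of_le (by norm_num), fun k hk => ?_, ?_⟩
    · obtain rfl : k = 0 := by omega
      exact h0
    · rw [h1]
      exact sub_ne_zero.2 hm

/-- If a periodic solution has a multiplier different from `1`, there are exactly two periodic
solutions, both hyperbolic. -/
theorem two_hyperbolic_of_variation_ne_one (h₂ : Continuous a₂) (h₁ : Continuous a₁)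
    (h₀ : Continuous a₀) (hp₂ : Function.Periodic a₂ T) (hp₁ : Function.Periodic a₁ T)
    (hp₀ : Function.Periodic a₀ T) (hne : ∀ t, a₂ t ≠ 0) (hT : 0 < T)
    (hx : IsPeriodicSolution (riccati a₂ a₁ a₀) T x) (hm : variation a₂ a₁ x T ≠ 1) :
    ∃ ψ, x ≠ ψ ∧ {φ | IsPeriodicSolution (riccati a₂ a₁ a₀) T φ} = {x, ψ} ∧
      IsHyperbolicLimitCycle (riccati a₂ a₁ a₀) T x ∧
      IsHyperbolicLimitCycle (riccati a₂ a₁ a₀) T ψ := by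
  obtain ⟨ψ, hψ, hrel⟩ := exists_second_periodic h₂ h₁ h₀ hp₂ hp₁ hp₀ hne hT hx
  have hc := variationIntegral_ne_zero h₂ h₁ hx.continuous hne hT
  have hne0 : ψ 0 ≠ x 0 := fun h => by
    rw [h, sub_self, zero_mul] at hrel
    exact hm (by linarith)
  -- Seen from `ψ`, a multiplier `1` would make `ψ` the only periodic solution, but `x` is another.
  have hmψ : variation a₂ a₁ ψ T ≠ 1 := fun h => by
    have hcψ := variationIntegral_ne_zero h₂ h₁ hψ.continuous hne hT
    have := (hψ.initial_relation h₂ h₁ hT hx).resolve_left hne0.symm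
    rw [h, sub_self] at this
    exact (mul_ne_zero (sub_ne_zero.2 hne0.symm) hcψ) this
  refine ⟨ψ, fun h => hne0 (by rw [h]), ?_,
    isHyperbolicLimitCycle_of_variation_ne_one h₂ h₁ hne hT hx hm,
    isHyperbolicLimitCycle_of_variation_ne_one h₂ h₁ hne hT hψ hmψ⟩
  ext φ
  refine ⟨fun hφ => ?_, ?_⟩
  · rcases hx.initial_relation h₂ h₁ hT hφ with h | h
    · exact Or.inl (hx.ext_riccati h₂ h₁ hT hφ h)
    · refine Or.inr (hψ.ext_riccati h₂ h₁ hT hφ ?_)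
      have := mul_right_cancel₀ hc (h.trans hrel.symm)
      linarith
  · rintro (rfl | rfl)
    · exact hx
    · exact hψ

theorem unique_double_of_variation_eq_one (h₂ : Continuous a₂) (h₁ : Continuous a₁)
    (hne : ∀ t, a₂ t ≠ 0) (hT : 0 < T) (hx : IsPeriodicSolution (riccati a₂ a₁ a₀) T x)
    (hm : variation a₂ a₁ x T = 1) :
    {ψ | IsPeriodicSolution (riccati a₂ a₁ a₀) T ψ} = {x} ∧
      IsDoubleLimitCycle (riccati a₂ a₁ a₀) T x := by
  have hc := variationIntegral_ne_zero h₂ h₁ hx.continuous hne hT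
  have huniq : ∀ ψ, IsPeriodicSolution (riccati a₂ a₁ a₀) T ψ → ψ = x := fun ψ hψ => by
    refine hx.ext_riccati h₂ h₁ hT hψ ?_
    rcases hx.initial_relation h₂ h₁ hT hψ with h | h
    · exact h
    · rw [hm, sub_self] at h
      exact sub_eq_zero.1 ((mul_eq_zero.1 h).resolve_right hc)
  refine ⟨?_, ⟨hx, 1, one_pos, fun ψ hψ _ => huniq ψ hψ⟩, ?_⟩
  · ext ψ
    refine ⟨fun h => huniq ψ h, ?_⟩
    rintro rfl
    exact hx
  · obtain ⟨hdom, hcd, h0, h1, h2⟩ := displacement_jet h₂ h₁ hT hx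
    refine ⟨hdom, hcd, fun k hk => ?_, ?_⟩
    · interval_cases k
      · exact h0
      · rw [h1, hm, sub_self]
    · rw [h2, hm]
      simpa using hc

/-! ### Semi-stability when the multiplier is one. -/

theorem periodic_bounds {k : ℝ → ℝ} (hT : 0 < T) (hk : Continuous k)
    (hp : Function.Periodic k T) (hpos : ∀ t, 0 < k t) :
    ∃ b > 0, ∃ B > 0, ∀ t, b ≤ k t ∧ k t ≤ B := by
  obtain ⟨s, -, hs⟩ := isCompact_Icc.exists_isMinOn (nonempty_Icc.2 hT.le) hk.continuousOn
  obtain ⟨r, -, hr⟩ := isCompact_Icc.exists_isMaxOn (nonempty_Icc.2 hT.le) hk.continuousOn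
  refine ⟨k s, hpos s, k r, hpos r, fun t => ?_⟩
  obtain ⟨t', ht', h⟩ := hp.exists_mem_Ico₀ hT t
  rw [h]
  exact ⟨hs (Ico_subset_Icc_self ht'), hr (Ico_subset_Icc_self ht')⟩

theorem variation_periodic (h₂ : Continuous a₂) (h₁ : Continuous a₁) (hx : Continuous x)
    (hp₂ : Function.Periodic a₂ T) (hp₁ : Function.Periodic a₁ T) (hpx : Function.Periodic x T)
    (hm : variation a₂ a₁ x T = 1) : Function.Periodic (variation a₂ a₁ x) T := by
  intro t
  have := periodic_primitive (k := fun s => 2 * a₂ s * x s + a₁ s) (T := T) (by fun_prop)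
    (fun t => by simp only [hp₂ t, hp₁ t, hpx t]) ((Real.exp_eq_one_iff _).1 hm) t
  simp only [variation] at this ⊢
  rw [this]

theorem tendsto_of_hyperbola_bound {w : ℝ → ℝ} {l : Filter ℝ} {C a : ℝ} (ha : 0 < a)
    (hl : Filter.Tendsto (fun t : ℝ => |t|) l Filter.atTop)
    (hw : ∀ᶠ t in l, |w t| ≤ C / (1 + a * |t|)) : Filter.Tendsto w l (𝓝 0) := by
  refine squeeze_zero_norm' (a := fun t => C / (1 + a * |t|)) hw ?_
  exact Filter.Tendsto.const_div_atTop
    (Filter.tendsto_atTop_add_const_left _ _ (hl.const_mul_atTop ha)) C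

/-- With multiplier `1` the variation is periodic, hence bounded, while `σ * variationIntegral`
increases at rate at least `b`. Offsets with `σ * h < 0` thus decay like `1 / t` forward in time,
and those with `σ * h > 0` backward. -/
theorem isSemiStable_of_variation_eq_one (h₂ : Continuous a₂) (h₁ : Continuous a₁)
    (hp₂ : Function.Periodic a₂ T) (hp₁ : Function.Periodic a₁ T)
    (hne : ∀ t, a₂ t ≠ 0) (hT : 0 < T) (hx : IsPeriodicSolution (riccati a₂ a₁ a₀) T x)
    (hm : variation a₂ a₁ x T = 1) : IsSemiStable (riccati a₂ a₁ a₀) x := by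
  obtain ⟨σ, hσ, hpos⟩ := exists_sign h₂ hne
  have hLc := continuous_variation h₂ h₁ hx.continuous
  have hLp := variation_periodic h₂ h₁ hx.continuous hp₂ hp₁ hx.2 hm
  obtain ⟨_, _, B, hB, hLB⟩ := periodic_bounds hT hLc hLp (variation_pos a₂ a₁ x)
  obtain ⟨b, hb, _, _, hGb⟩ := periodic_bounds (k := fun t => σ * a₂ t * variation a₂ a₁ x t) hT
    (by fun_prop) (fun t => by simp only [hp₂ t, hLp t])
    (fun t => mul_pos (hpos t) (variation_pos a₂ a₁ x t))
  have hmono : Monotone fun t => σ * variationIntegral a₂ a₁ x t - b * t := by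
    refine monotone_of_hasDerivAt_nonneg (fun t =>
      ((hasDerivAt_variationIntegral h₂ h₁ hx.continuous t).const_mul σ).sub
        ((hasDerivAt_id t).const_mul b)) (fun t => ?_)
    have := (hGb t).1
    simp only [Pi.zero_apply]
    linarith
  have hσσ : σ * σ = 1 := by rcases hσ with rfl | rfl <;> norm_num
  have hden : ∀ h t, (σ * h ≤ 0 ∧ 0 ≤ t) ∨ (0 ≤ σ * h ∧ t ≤ 0) →
      1 + |h| * b * |t| ≤ 1 - h * variationIntegral a₂ a₁ x t := by
    intro h t hht
    have e : h * variationIntegral a₂ a₁ x t = (σ * h) * (σ * variationIntegral a₂ a₁ x t) := by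
      rw [mul_mul_mul_comm, hσσ, one_mul]
    have eh : |h| = |σ * h| := by rcases hσ with rfl | rfl <;> simp
    rw [e, eh]
    rcases hht with ⟨h1, h2⟩ | ⟨h1, h2⟩
    · have := hmono h2
      simp only [variationIntegral_zero] at this
      rw [abs_of_nonpos h1, abs_of_nonneg h2]
      nlinarith
    · have := hmono h2
      simp only [variationIntegral_zero] at this
      rw [abs_of_nonneg h1, abs_of_nonpos h2]
      nlinarith
  have hbound : ∀ h t, (σ * h ≤ 0 ∧ 0 ≤ t) ∨ (0 ≤ σ * h ∧ t ≤ 0) →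
      |h * variation a₂ a₁ x t / (1 - h * variationIntegral a₂ a₁ x t)|
        ≤ |h| * B / (1 + |h| * b * |t|) := by
    intro h t hht
    have h1 := hden h t hht
    have h2 : 0 < 1 + |h| * b * |t| := by positivity
    rw [abs_div, abs_mul, abs_of_pos (h2.trans_le h1), abs_of_pos (variation_pos a₂ a₁ x t)]
    gcongr
    exact (hLB t).2
  have hsmall : ∀ ε, ∀ h t, |h| < ε / B → (σ * h ≤ 0 ∧ 0 ≤ t) ∨ (0 ≤ σ * h ∧ t ≤ 0) →
      |h * variation a₂ a₁ x t / (1 - h * variationIntegral a₂ a₁ x t)| < ε := by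
    intro ε h t hh hht
    refine (hbound h t hht).trans_lt ?_
    rw [lt_div_iff₀ hB] at hh
    refine (div_le_self (by positivity) ?_).trans_lt hh
    have : 0 ≤ |h| * b * |t| := by positivity
    linarith
  have hsol : ∀ h t, (σ * h ≤ 0 ∧ 0 ≤ t) ∨ (0 ≤ σ * h ∧ t ≤ 0) →
      1 - h * variationIntegral a₂ a₁ x t ≠ 0 := by
    intro h t hht
    have h1 := hden h t hht
    have h2 : 0 ≤ |h| * b * |t| := by positivity
    linarith
  have hattr : AttractsFromSide (riccati a₂ a₁ a₀) (-σ) x := by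
    intro ε hε
    refine ⟨ε / B, by positivity, fun y hy hy' => ?_⟩
    have hs : σ * (y - x 0) ≤ 0 := by linarith
    have habs : |y - x 0| < ε / B := by
      rcases hσ with rfl | rfl
      · rw [abs_of_nonpos (by linarith)]; linarith
      · rw [abs_of_nonneg (by linarith)]; linarith
    have hy0 : 0 < |y - x 0| := abs_pos.2 fun h => by simp [h] at hy
    refine ⟨_, fun t ht => (hasDerivAt_riccati_perturbation h₂ h₁ hx.hasDerivAt (y - x 0) t
      (hsol _ t (Or.inl ⟨hs, ht⟩))).hasDerivWithinAt, by
        simp [variation_zero, variationIntegral_zero], fun t ht => ?_, ?_⟩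
    · rw [add_sub_cancel_left]
      exact hsmall ε _ t habs (Or.inl ⟨hs, ht⟩)
    · simp only [add_sub_cancel_left]
      refine tendsto_of_hyperbola_bound (C := |y - x 0| * B) (mul_pos hy0 hb) Filter.tendsto_abs_atTop_atTop ?_
      filter_upwards [Filter.eventually_ge_atTop 0] with t ht using hbound _ t (Or.inl ⟨hs, ht⟩)
  have hrep : RepelsFromSide (riccati a₂ a₁ a₀) σ x := by
    intro ε hε
    refine ⟨ε / B, by positivity, fun y hy hy' => ?_⟩
    have habs : |y - x 0| < ε / B := by
      rcases hσ with rfl | rfl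
      · rw [abs_of_nonneg (by linarith)]; linarith
      · rw [abs_of_nonpos (by linarith)]; linarith
    have hy0 : 0 < |y - x 0| := abs_pos.2 fun h => by simp [h] at hy
    refine ⟨_, fun t ht => (hasDerivAt_riccati_perturbation h₂ h₁ hx.hasDerivAt (y - x 0) t
      (hsol _ t (Or.inr ⟨hy.le, ht⟩))).hasDerivWithinAt, by
        simp [variation_zero, variationIntegral_zero], fun t ht => ?_, ?_⟩
    · rw [add_sub_cancel_left]
      exact hsmall ε _ t habs (Or.inr ⟨hy.le, ht⟩)
    · simp only [add_sub_cancel_left]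
      refine tendsto_of_hyperbola_bound (C := |y - x 0| * B) (mul_pos hy0 hb) Filter.tendsto_abs_atBot_atTop ?_
      filter_upwards [Filter.eventually_le_atBot 0] with t ht
        using hbound _ t (Or.inr ⟨hy.le, ht⟩)
  rcases hσ with rfl | rfl
  · exact Or.inr ⟨hattr, hrep⟩
  · rw [neg_neg] at hattr
    exact Or.inl ⟨hattr, hrep⟩

end Periodic

/-! ### Periodic solutions of `x' = x ^ 2 + g(t) + lam` -/

/-- The right-hand side `x ^ 2 + g(t) + lam`. -/
def reduced (g : ℝ → ℝ) (lam : ℝ) : ℝ → ℝ → ℝ :=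
  riccati (fun _ => 1) (fun _ => 0) (fun t => g t + lam)

theorem reduced_apply (g : ℝ → ℝ) (lam t y : ℝ) : reduced g lam t y = y ^ 2 + g t + lam := by
  simp [reduced, riccati]
  ring

/-! ### The truncated equation and its time-`T` map. -/

/-- The truncation of the real line to `[-M, M]`. -/
def clamp (M y : ℝ) : ℝ := max (-M) (min y M)

theorem abs_clamp_le {M : ℝ} (hM : 0 ≤ M) (y : ℝ) : |clamp M y| ≤ M :=
  abs_le.2 ⟨le_max_left _ _, max_le (by linarith) (min_le_right _ _)⟩

theorem clamp_of_abs_le {M y : ℝ} (h : |y| ≤ M) : clamp M y = y := by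
  rw [abs_le] at h
  rw [clamp, min_eq_left h.2, max_eq_right h.1]

theorem clamp_sq_of_lt_abs {M y : ℝ} (hM : 0 ≤ M) (h : M < |y|) : clamp M y ^ 2 = M ^ 2 := by
  rcases lt_abs.1 h with h | h
  · rw [clamp, min_eq_right h.le, max_eq_right (by linarith)]
  · rw [clamp, min_eq_left (by linarith), max_eq_left (by linarith), neg_sq]

theorem abs_clamp_sub_le (M x y : ℝ) : |clamp M x - clamp M y| ≤ |x - y| :=
  (abs_max_sub_max_le_max _ _ _ _).trans (by
    rw [sub_self, abs_zero]
    refine max_le (abs_nonneg _) ((abs_min_sub_min_le_max _ _ _ _).trans ?_)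
    rw [sub_self, abs_zero]
    exact max_le le_rfl (abs_nonneg _))

theorem abs_clamp_sq_sub_le {M : ℝ} (hM : 0 ≤ M) (x y : ℝ) :
    |clamp M x ^ 2 - clamp M y ^ 2| ≤ 2 * M * |x - y| := by
  rw [sq_sub_sq, abs_mul]
  refine mul_le_mul ((abs_add_le _ _).trans ?_) (abs_clamp_sub_le M x y) (abs_nonneg _)
    (by positivity)
  linarith [abs_clamp_le hM x, abs_clamp_le hM y]

/-- The field `x ^ 2 + g(t) + lam` with the quadratic term truncated outside `[-M, M]`. -/
def truncated (M : ℝ) (g : ℝ → ℝ) (lam t y : ℝ) : ℝ := clamp M y ^ 2 + g t + lam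

theorem lipschitzWith_truncated {M : ℝ} (hM : 0 ≤ M) (g : ℝ → ℝ) (lam t : ℝ) :
    LipschitzWith (2 * M).toNNReal (truncated M g lam t) := by
  refine LipschitzWith.of_dist_le_mul fun x y => ?_
  rw [Real.dist_eq, Real.dist_eq, Real.coe_toNNReal _ (by positivity)]
  refine le_trans (le_of_eq ?_) (abs_clamp_sq_sub_le hM x y)
  simp only [truncated]
  congr 1
  ring

theorem continuous_uncurry_truncated (M : ℝ) {g : ℝ → ℝ} (hg : Continuous g) (lam : ℝ) :
    Continuous (Function.uncurry (truncated M g lam)) := by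
  simp only [Function.uncurry_def, truncated, clamp]
  fun_prop

/-- The truncated field is bounded uniformly in `y`, so with radius bound times `T` Picard–Lindelöf
reaches the whole interval at once. -/
theorem exists_truncated_solution {M T : ℝ} (hM : 0 ≤ M) (hT : 0 < T) {g : ℝ → ℝ}
    (hg : Continuous g) (lam a : ℝ) :
    ∃ u, IsSolutionOn (truncated M g lam) (Icc 0 T) u ∧ u 0 = a := by
  obtain ⟨B, hB⟩ := isCompact_Icc.exists_bound_of_continuousOn (hg.continuousOn (s := Icc 0 T))
  have hB0 : 0 ≤ B := (norm_nonneg _).trans (hB 0 ⟨le_rfl, hT.le⟩)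
  have hbound : 0 ≤ M ^ 2 + B + |lam| := by positivity
  have hPL : IsPicardLindelof (truncated M g lam) (tmin := 0) (tmax := T)
      ⟨0, le_rfl, hT.le⟩ a ((M ^ 2 + B + |lam|) * T).toNNReal 0 (M ^ 2 + B + |lam|).toNNReal
      (2 * M).toNNReal :=
    { lipschitzOnWith := fun t _ => (lipschitzWith_truncated hM g lam t).lipschitzOnWith
      continuousOn := fun y _ => by
        simp only [truncated]
        fun_prop
      norm_le := fun t ht y _ => by
        rw [Real.coe_toNNReal _ hbound]
        have h1 : clamp M y ^ 2 ≤ M ^ 2 := sq_le_sq' (abs_le.1 (abs_clamp_le hM y)).1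
          (abs_le.1 (abs_clamp_le hM y)).2
        have h2 := hB t ht
        refine (norm_add_le _ _).trans (add_le_add ((norm_add_le _ _).trans
          (add_le_add ?_ h2)) le_rfl)
        rwa [Real.norm_of_nonneg (sq_nonneg _)]
      mul_max_le := by
        rw [Real.coe_toNNReal _ hbound, Real.coe_toNNReal _ (by positivity)]
        simp [hT.le] }
  obtain ⟨u, hu0, hu⟩ := hPL.exists_eq_forall_mem_Icc_hasDerivWithinAt₀
  exact ⟨u, hu, hu0⟩

/-- A solution for `lam'` is an approximate solution for `lam` with error `|lam - lam'|`; Grönwall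
does the rest. -/
theorem dist_truncated_solutions_le {M T : ℝ} (hM : 0 < M) (hT : 0 < T) {g : ℝ → ℝ} :
    ∃ C : ℝ, 0 ≤ C ∧ ∀ lam lam' u v, IsSolutionOn (truncated M g lam) (Icc 0 T) u →
      IsSolutionOn (truncated M g lam') (Icc 0 T) v →
      |u T - v T| ≤ C * (|lam - lam'| + |u 0 - v 0|) := by
  have hK : (0 : ℝ) < 2 * M := by positivity
  have hexp : 1 ≤ Real.exp (2 * M * T) := Real.one_le_exp (by positivity)
  refine ⟨Real.exp (2 * M * T) + (Real.exp (2 * M * T) - 1) / (2 * M),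
    add_nonneg (by positivity) (div_nonneg (by linarith) hK.le), fun lam lam' u v hu hv => ?_⟩
  have hright : ∀ {w w' : ℝ → ℝ}, (∀ t ∈ Icc 0 T, HasDerivWithinAt w (w' t) (Icc 0 T) t) →
      ∀ t ∈ Ico 0 T, HasDerivWithinAt w (w' t) (Ici t) t := fun h t ht =>
    (h t (Ico_subset_Icc_self ht)).mono_of_mem_nhdsWithin (Icc_mem_nhdsGE_of_mem ht)
  have := dist_le_of_approx_trajectories_ODE (v := truncated M g lam)
    (fun t => lipschitzWith_truncated hM.le g lam t)
    (fun t ht => (hu t ht).continuousWithinAt) (hright hu) (εf := 0) (fun t _ => by simp)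
    (fun t ht => (hv t ht).continuousWithinAt) (hright hv) (εg := |lam - lam'|) (fun t _ => by
      rw [dist_comm, Real.dist_eq]
      exact le_of_eq (by simp only [truncated]; congr 1; ring))
    le_rfl T ⟨hT.le, le_rfl⟩
  rw [Real.coe_toNNReal _ hK.le, gronwallBound_of_K_ne_0 hK.ne', Real.dist_eq, Real.dist_eq,
    sub_zero, zero_add] at this
  beta_reduce at this
  refine this.trans ?_
  have h1 : 0 ≤ |u 0 - v 0| * ((Real.exp (2 * M * T) - 1) / (2 * M)) :=
    mul_nonneg (abs_nonneg _) (div_nonneg (by linarith) hK.le)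
  have h2 : 0 ≤ |lam - lam'| * Real.exp (2 * M * T) := by positivity
  have h3 : |lam - lam'| / (2 * M) * (Real.exp (2 * M * T) - 1)
    = |lam - lam'| * ((Real.exp (2 * M * T) - 1) / (2 * M)) := by ring
  rw [h3]
  linarith

/-- The time-`T` map of the truncated equation is defined everywhere and depends continuously on
the parameter and on the initial condition. -/
theorem exists_truncated_flow {M T : ℝ} (hM : 0 < M) (hT : 0 < T) {g : ℝ → ℝ}
    (hg : Continuous g) :
    ∃ P : ℝ × ℝ → ℝ, Continuous P ∧
      (∀ q, ∃ u, IsSolutionOn (truncated M g q.1) (Icc 0 T) u ∧ u 0 = q.2 ∧ u T = P q) ∧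
      ∀ lam u, IsSolutionOn (truncated M g lam) (Icc 0 T) u → u T = P (lam, u 0) := by
  choose U hU hU0 using fun q : ℝ × ℝ => exists_truncated_solution hM.le hT hg q.1 q.2
  obtain ⟨C, hC, H⟩ := dist_truncated_solutions_le (g := g) hM hT
  refine ⟨fun q => U q T, ?_, fun q => ⟨U q, hU q, hU0 q, rfl⟩, fun lam u hu => ?_⟩
  · refine (LipschitzWith.of_dist_le_mul (K := (2 * C).toNNReal) fun q r => ?_).continuous
    have := H _ _ _ _ (hU q) (hU r)
    rw [hU0, hU0] at this
    rw [Real.coe_toNNReal _ (by positivity), Real.dist_eq]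
    refine this.trans ?_
    have h1 : |q.1 - r.1| ≤ dist q r := le_max_left _ _
    have h2 : |q.2 - r.2| ≤ dist q r := le_max_right _ _
    nlinarith
  · have := H _ _ _ _ hu (hU (lam, u 0))
    rw [hU0, sub_self, sub_self, abs_zero, add_zero, mul_zero] at this
    exact sub_eq_zero.1 (abs_nonpos_iff.1 this)

/-! ### A priori bounds and existence of periodic solutions. -/

theorem exists_critical_point {T : ℝ} (hT : 0 < T) {φ φ' : ℝ → ℝ}
    (hd : ∀ t, HasDerivAt φ (φ' t) t) (hp : φ T = φ 0) : ∃ s ∈ Ioo 0 T, φ' s = 0 :=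
  exists_hasDerivAt_eq_zero hT (fun t _ => (hd t).continuousAt.continuousWithinAt) hp.symm
    fun t _ => hd t

/-- At a maximum of `φ ^ 2` the product `φ φ'` vanishes, which is impossible where `|φ| > M`. -/
theorem IsPeriodicSolution.abs_le_of_ne_zero {f : ℝ → ℝ → ℝ} {T M : ℝ} {φ : ℝ → ℝ} (hT : 0 < T)
    (hM : 0 ≤ M) (h : IsPeriodicSolution f T φ) (hf : ∀ t y, M < |y| → f t y ≠ 0) (t : ℝ) :
    |φ t| ≤ M := by
  have hc := h.continuous
  obtain ⟨s, -, hs⟩ := isCompact_Icc.exists_isMaxOn (nonempty_Icc.2 hT.le)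
    (show ContinuousOn (fun t => φ t ^ 2) (Icc 0 T) by fun_prop)
  have hmax : ∀ t, φ t ^ 2 ≤ φ s ^ 2 := fun t => by
    obtain ⟨t', ht', e⟩ := h.2.exists_mem_Ico₀ hT t
    rw [e]
    exact hs (Ico_subset_Icc_self ht')
  have hzero : 2 * φ s ^ 1 * f s (φ s) = 0 :=
    IsLocalMax.hasDerivAt_eq_zero (Filter.Eventually.of_forall hmax) ((h.hasDerivAt s).pow 2)
  have hsM : |φ s| ≤ M := by
    by_contra! hlt
    refine mul_ne_zero (mul_ne_zero two_ne_zero (pow_ne_zero _ ?_)) (hf s _ hlt) hzero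
    exact abs_pos.1 (hM.trans_lt hlt)
  exact (sq_le_sq.1 (hmax t)).trans hsM

theorem abs_le_of_reduced {T M lam : ℝ} {g φ : ℝ → ℝ} (hT : 0 < T) (hM : 0 ≤ M)
    (hpos : ∀ t, 0 < M ^ 2 + g t + lam) (h : IsPeriodicSolution (reduced g lam) T φ) (t : ℝ) :
    |φ t| ≤ M := by
  refine h.abs_le_of_ne_zero hT hM (fun t y hy => ?_) t
  rw [reduced_apply]
  have : M ^ 2 < y ^ 2 := by rwa [sq_lt_sq, abs_of_nonneg hM]
  linarith [hpos t]

/-- Beyond `M` the truncated field equals `M ^ 2 + g + lam > 0`, so periodic solutions stay in `[-M,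
M]` and never meet the truncation. -/
theorem reduced_of_truncated {T M lam : ℝ} {g φ : ℝ → ℝ} (hT : 0 < T) (hM : 0 ≤ M)
    (hpos : ∀ t, 0 < M ^ 2 + g t + lam) (h : IsPeriodicSolution (truncated M g lam) T φ) :
    IsPeriodicSolution (reduced g lam) T φ := by
  have hb := h.abs_le_of_ne_zero hT hM fun t y hy => by
    rw [truncated, clamp_sq_of_lt_abs hM hy]
    exact (hpos t).ne'
  refine ⟨fun t ht => (h.1 t ht).congr_deriv ?_, h.2⟩
  rw [reduced_apply, truncated, clamp_of_abs_le (hb t)]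

theorem exists_reduced_of_truncated_fixed {T M lam : ℝ} {g u : ℝ → ℝ} (hT : 0 < T) (hM : 0 ≤ M)
    (hg : Continuous g) (hgp : Function.Periodic g T) (hpos : ∀ t, 0 < M ^ 2 + g t + lam)
    (hu : IsSolutionOn (truncated M g lam) (Icc 0 T) u) (h : u 0 = u T) :
    ∃ φ, IsPeriodicSolution (reduced g lam) T φ := by
  obtain ⟨φ, hφ, -⟩ := exists_periodic_extension hT (continuous_uncurry_truncated M hg lam)
    (fun t y => by simp only [truncated, hgp t]) hu h
  exact ⟨φ, reduced_of_truncated hT hM hpos hφ⟩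

/-- A strict periodic upper solution forces the existence of a periodic solution. -/
theorem exists_periodic_of_upper_solution {T lam : ℝ} {g p p' : ℝ → ℝ} (hT : 0 < T)
    (hg : Continuous g) (hgp : Function.Periodic g T) (hd : ∀ t, HasDerivAt p (p' t) t)
    (hp : Function.Periodic p T) (hlt : ∀ t, p t ^ 2 + g t + lam < p' t) :
    ∃ φ, IsPeriodicSolution (reduced g lam) T φ := by
  have hpc : Continuous p := continuous_iff_continuousAt.2 fun t => (hd t).continuousAt
  obtain ⟨_, _, B, hB, hBp⟩ := periodic_bounds (k := fun t => 1 + |p t|) hT (by fun_prop)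
    (fun t => by simp only [hp t]) fun t => by positivity
  obtain ⟨_, _, C, hC, hCg⟩ := periodic_bounds (k := fun t => 1 + |g t + lam|) hT (by fun_prop)
    (fun t => by simp only [hgp t]) fun t => by positivity
  set M := 1 + B + C with hMdef
  have hM : 0 < M := by positivity
  have hpM : ∀ t, |p t| ≤ M := fun t => by linarith [(hBp t).2]
  have hpos : ∀ t, 0 < M ^ 2 + g t + lam := fun t => by
    have h1 := (hCg t).2
    have h2 := neg_abs_le (g t + lam)
    nlinarith
  obtain ⟨P, hPc, hP, -⟩ := exists_truncated_flow hM hT hg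
  -- At a contact with `p` the solution has the smaller slope, so it cannot cross `p` upwards.
  have hle : P (lam, p 0) - p 0 ≤ 0 := by
    obtain ⟨u, hu, hu0, huT⟩ := hP (lam, p 0)
    rw [← huT, ← hp.eq]
    refine sub_nonpos.2 (image_le_of_deriv_right_lt_deriv_boundary
      (fun t ht => (hu t ht).continuousWithinAt) (fun t ht =>
        (hu t (Ico_subset_Icc_self ht)).mono_of_mem_nhdsWithin (Icc_mem_nhdsGE_of_mem ht))
      hu0.le hd (fun t _ htp => ?_) ⟨hT.le, le_rfl⟩)
    rw [truncated, htp, clamp_of_abs_le (hpM t)]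
    exact hlt t
  -- The field is positive at height `M`, so the constant `M` is a barrier from below; a fixed point
  -- lies between `p 0` and `M`.
  have hge : 0 ≤ P (lam, M) - M := by
    obtain ⟨u, hu, hu0, huT⟩ := hP (lam, M)
    rw [← huT]
    refine sub_nonneg.2 (image_le_of_deriv_right_lt_deriv_boundary' (f := fun _ => M)
      (f' := fun _ => 0) continuousOn_const (fun t _ => hasDerivWithinAt_const _ _ _)
      hu0.ge (fun t ht => (hu t ht).continuousWithinAt) (fun t ht =>
        (hu t (Ico_subset_Icc_self ht)).mono_of_mem_nhdsWithin (Icc_mem_nhdsGE_of_mem ht))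
      (fun t _ htp => ?_) ⟨hT.le, le_rfl⟩)
    rw [truncated, ← htp, clamp_of_abs_le (abs_of_pos hM).le]
    exact hpos t
  obtain ⟨a, -, ha⟩ := intermediate_value_Icc (f := fun a => P (lam, a) - a)
    ((le_abs_self _).trans (hpM 0)) (by fun_prop) ⟨hle, hge⟩
  obtain ⟨u, hu, hu0, huT⟩ := hP (lam, a)
  refine exists_reduced_of_truncated_fixed hT hM.le hg hgp hpos hu ?_
  rw [hu0, huT]
  exact (sub_eq_zero.1 ha).symm

/-- For parameters at least `-B`, periodic solutions of the reduced equation are fixed points of one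
continuous map `P` in a compact box, on which `lam` attains its maximum. The set is nonempty since
`0` is a strict upper solution at `-B`, and a critical point of a solution forces `lam ≤ B`. -/
theorem exists_maximal_periodic {T : ℝ} {g : ℝ → ℝ} (hT : 0 < T) (hg : Continuous g)
    (hgp : Function.Periodic g T) :
    ∃ lam φ, IsPeriodicSolution (reduced g lam) T φ ∧
      ∀ mu ψ, IsPeriodicSolution (reduced g mu) T ψ → mu ≤ lam := by
  obtain ⟨_, _, B, hB, hBg⟩ := periodic_bounds (k := fun t => 1 + |g t|) hT (by fun_prop)
    (fun t => by simp only [hgp t]) fun t => by positivity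
  have hgB : ∀ t, |g t| < B := fun t => by linarith [(hBg t).2]
  set M := 1 + 2 * B with hMdef
  have hM : 0 < M := by positivity
  have hpos : ∀ mu, -B ≤ mu → ∀ t, 0 < M ^ 2 + g t + mu := fun mu hmu t => by
    have := (abs_lt.1 (hgB t)).1
    nlinarith
  obtain ⟨P, hPc, hP, hPu⟩ := exists_truncated_flow hM hT hg
  set K : Set (ℝ × ℝ) := (Icc (-B) B ×ˢ Icc (-M) M) ∩ {q | P q = q.2}
  have hK : IsCompact K := (isCompact_Icc.prod isCompact_Icc).inter_right
    (isClosed_eq hPc continuous_snd)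
  have hup : ∀ mu ψ, IsPeriodicSolution (reduced g mu) T ψ → mu ≤ B := by
    intro mu ψ hψ
    obtain ⟨s, -, hs⟩ := exists_critical_point hT hψ.hasDerivAt hψ.2.eq
    rw [reduced_apply] at hs
    nlinarith [(abs_lt.1 (hgB s)).1]
  have hmem : ∀ mu ψ, -B ≤ mu → IsPeriodicSolution (reduced g mu) T ψ → (mu, ψ 0) ∈ K := by
    intro mu ψ hmu hψ
    have hb := abs_le_of_reduced hT hM.le (hpos mu hmu) hψ
    refine ⟨⟨⟨hmu, hup mu ψ hψ⟩, abs_le.1 (hb 0)⟩, ?_⟩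
    have := hPu mu ψ fun t _ => by
      refine (hψ.hasDerivAt t).hasDerivWithinAt.congr_deriv ?_
      rw [reduced_apply, truncated, clamp_of_abs_le (hb t)]
    rw [hψ.2.eq] at this
    exact this.symm
  obtain ⟨ψ, hψ⟩ := exists_periodic_of_upper_solution (lam := -B) (p := fun _ => 0)
    (p' := fun _ => 0) hT hg hgp (fun t => hasDerivAt_const _ _) (fun _ => rfl) fun t => by
      linarith [(abs_lt.1 (hgB t)).2]
  have hψK := hmem _ ψ le_rfl hψ
  obtain ⟨⟨lam, a⟩, hqK, hmax⟩ := hK.exists_isMaxOn ⟨_, hψK⟩ continuous_fst.continuousOn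
  obtain ⟨u, hu, hu0, huT⟩ := hP (lam, a)
  have hlam : -B ≤ lam := hqK.1.1.1
  obtain ⟨φ, hφ⟩ := exists_reduced_of_truncated_fixed hT hM.le hg hgp (hpos lam hlam) hu
    (by rw [hu0, huT]; exact hqK.2.symm)
  refine ⟨lam, φ, hφ, fun mu χ hχ => ?_⟩
  rcases le_total (-B) mu with h | h
  · exact hmax (hmem mu χ h hχ)
  · exact h.trans hlam

theorem variation_reduced (φ : ℝ → ℝ) (T : ℝ) :
    variation (fun _ => 1) (fun _ => 0) φ T = Real.exp (2 * ∫ t in (0 : ℝ)..T, φ t) := by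
  simp [variation]

/-- The largest parameter with a periodic solution has a periodic solution of zero mean. -/
theorem exists_zero_mean_periodic {T : ℝ} {g : ℝ → ℝ} (hT : 0 < T) (hg : Continuous g)
    (hgp : Function.Periodic g T) :
    ∃ lam φ, IsPeriodicSolution (reduced g lam) T φ ∧ ∫ t in (0 : ℝ)..T, φ t = 0 := by
  obtain ⟨lam, φ, hφ, hmax⟩ := exists_maximal_periodic hT hg hgp
  refine ⟨lam, φ, hφ, ?_⟩
  by_contra hmean
  have hm : variation (fun _ => 1) (fun _ => 0) φ T ≠ 1 := by
    rw [variation_reduced, Ne, Real.exp_eq_one_iff]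
    simpa using hmean
  obtain ⟨ψ, hψ, hrel⟩ := exists_second_periodic continuous_const continuous_const
    (a₀ := fun t => g t + lam) (by fun_prop) (fun _ => rfl) (fun _ => rfl)
    (fun t => by simp only [hgp t]) (fun _ => one_ne_zero) hT hφ
  have hne0 : ψ 0 - φ 0 ≠ 0 := fun h => by
    rw [h, zero_mul] at hrel
    exact hm (by linarith)
  have hφc := hφ.continuous
  have hψc := hψ.continuous
  -- The two solutions never meet: at a meeting point the relation would make a nonzero multiple of
  -- the variation vanish.
  have hne : ∀ t, 0 < (ψ t - φ t) ^ 2 := fun t => by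
    obtain ⟨s, hs, e⟩ := (hψ.2.sub hφ.2).exists_mem_Ico₀ hT t
    simp only [Pi.sub_apply] at e
    rw [e]
    have := riccati_solution_relation continuous_const continuous_const hφ.hasDerivAt
      (fun t _ => (hψ.hasDerivAt t).hasDerivWithinAt) (Ico_subset_Icc_self hs)
    refine sq_pos_iff.2 fun h => ?_
    rw [h, zero_mul] at this
    exact mul_ne_zero hne0 (variation_pos ..).ne' this.symm
  obtain ⟨b, hb, _, _, hbd⟩ := periodic_bounds (k := fun t => (ψ t - φ t) ^ 2) hT (by fun_prop)
    (fun t => by simp only [hψ.2 t, hφ.2 t]) hne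
  -- For the midpoint `p`, `p' - p ^ 2 - g - lam = (ψ - φ) ^ 2 / 4 ≥ b / 4`, which leaves room to
  -- raise `lam` by `b / 8`.
  obtain ⟨χ, hχ⟩ := exists_periodic_of_upper_solution (lam := lam + b / 8) hT hg hgp
    (fun t => ((hφ.hasDerivAt t).add (hψ.hasDerivAt t)).div_const 2)
    (fun t => by simp only [Pi.add_apply, hφ.2 t, hψ.2 t]) fun t => by
      have := (hbd t).1
      rw [reduced_apply]
      change _ < (φ t ^ 2 + g t + lam + reduced g lam t (ψ t)) / 2
      rw [reduced_apply]
      simp only [Pi.add_apply]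
      nlinarith
  linarith [hmax _ _ hχ]

/-! ### The variational characterization of the critical parameter -/

theorem weight_pos (q : ℝ → ℝ) (t : ℝ) : 0 < weight q t := Real.exp_pos _

theorem weight_zero (q : ℝ → ℝ) : weight q 0 = 1 := by simp [weight]

theorem weight_eq_one {q : ℝ → ℝ} {T : ℝ} (h : ∫ t in (0 : ℝ)..T, q t = 0) : weight q T = 1 := by
  simp [weight, h]

theorem hasDerivAt_weight {q : ℝ → ℝ} (hq : Continuous q) (t : ℝ) :
    HasDerivAt (weight q) (-2 * q t * weight q t) t := by
  have := ((hasDerivAt_primitive hq t).const_mul (-2)).exp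
  rw [mul_comm]
  exact this

theorem continuous_weight {q : ℝ → ℝ} (hq : Continuous q) : Continuous (weight q) :=
  continuous_iff_continuousAt.2 fun t => (hasDerivAt_weight hq t).continuousAt

theorem average_eq_zero_iff {T : ℝ} (hT : 0 < T) (q : ℝ → ℝ) :
    average T q = 0 ↔ ∫ t in (0 : ℝ)..T, q t = 0 := by
  simp [average, hT.ne']

theorem mem_C1T_of_reduced {T lam : ℝ} {g φ : ℝ → ℝ} (hg : Continuous g)
    (hφ : IsPeriodicSolution (reduced g lam) T φ) : φ ∈ C1T T := by
  have hc := hφ.continuous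
  refine ⟨contDiff_one_iff_deriv.2 ⟨fun t => (hφ.hasDerivAt t).differentiableAt, ?_⟩, hφ.2⟩
  rw [show deriv φ = fun t => φ t ^ 2 + g t + lam from
    funext fun t => by rw [(hφ.hasDerivAt t).deriv, reduced_apply]]
  fun_prop

section Characterization

variable {T lam : ℝ} {γ φ : ℝ → ℝ}

/-- No mean condition is imposed, so every periodic solution bounds `γ^*` from below; this excludes
periodic solutions when the discriminant is negative. -/
theorem muLower_of_periodic (hT : 0 < T)
    (hφ : IsPeriodicSolution (reduced (centered T γ) lam) T φ) : muLower T γ φ = lam := by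
  have : (fun t => φ t ^ 2 + centered T γ t - deriv φ t) = fun _ => -lam := funext fun t => by
    rw [(hφ.hasDerivAt t).deriv, reduced_apply]
    ring
  rw [muLower, this, (nonempty_Icc.2 hT.le).image_const, csSup_singleton, neg_neg]

/-- Zero mean makes `(p - φ) * weight φ` periodic. At its critical point `p' = φ' + 2 φ (p - φ)`, so
`p ^ 2 + γ̂ - p' = (p - φ) ^ 2 - lam ≥ -lam`. -/
theorem muLower_le (hT : 0 < T) (hγ : Continuous γ)
    (hφ : IsPeriodicSolution (reduced (centered T γ) lam) T φ)
    (hmean : ∫ t in (0 : ℝ)..T, φ t = 0) {p : ℝ → ℝ} (hp : p ∈ C1T T) :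
    muLower T γ p ≤ lam := by
  by_contra! hlt
  have hpc := hp.1.continuous
  have hpd : ∀ t, HasDerivAt p (deriv p t) t :=
    fun t => (hp.1.differentiable one_ne_zero t).hasDerivAt
  have hgc : Continuous (centered T γ) := hγ.sub continuous_const
  have hp' : Continuous (deriv p) := (contDiff_one_iff_deriv.1 hp.1).2
  have hbdd : BddAbove ((fun t => p t ^ 2 + centered T γ t - deriv p t) '' Icc 0 T) :=
    (isCompact_Icc.image (by fun_prop)).bddAbove
  have hle : ∀ t ∈ Icc 0 T, p t ^ 2 + centered T γ t - deriv p t ≤ -muLower T γ p := by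
    intro t ht
    rw [muLower, neg_neg]
    exact le_csSup hbdd (mem_image_of_mem _ ht)
  obtain ⟨s, hs, h0⟩ := exists_critical_point hT (φ := fun t => (p t - φ t) * weight φ t)
    (fun t => ((hpd t).sub (hφ.hasDerivAt t)).mul (hasDerivAt_weight hφ.continuous t))
    (by rw [hp.2.eq, hφ.2.eq, weight_eq_one hmean, weight_zero])
  have h1 := hle s (Ioo_subset_Icc_self hs)
  rw [reduced_apply] at h0
  have h2 : (deriv p s - (φ s ^ 2 + centered T γ s + lam) - 2 * φ s * (p s - φ s)) * weight φ s
      = 0 := by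
    simp only [Pi.sub_apply] at h0
    linarith
  have h3 := (mul_eq_zero.1 h2).resolve_right (weight_pos φ s).ne'
  nlinarith [sq_nonneg (p s - φ s)]

/-- The derivative of `φ * weight q` is integrated over a period and the square is completed; the
boundary terms cancel because `q` has zero mean. -/
theorem weighted_identity (hγ : Continuous γ)
    (hφ : IsPeriodicSolution (reduced (centered T γ) lam) T φ) {q : ℝ → ℝ} (hq : Continuous q)
    (hmean : ∫ t in (0 : ℝ)..T, q t = 0) :
    ∫ t in (0 : ℝ)..T, weight q t * (q t ^ 2 - centered T γ t) =
      (∫ t in (0 : ℝ)..T, weight q t * (φ t - q t) ^ 2) +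
        lam * ∫ t in (0 : ℝ)..T, weight q t := by
  have hc := hφ.continuous
  have hw := continuous_weight hq
  have hgc : Continuous (centered T γ) := hγ.sub continuous_const
  have hint := intervalIntegral.integral_eq_sub_of_hasDerivAt (a := 0) (b := T)
    (f := fun t => φ t * weight q t)
    (f' := fun t => weight q t * (φ t - q t) ^ 2 + lam * weight q t
      - weight q t * (q t ^ 2 - centered T γ t))
    (fun t _ => ((hφ.hasDerivAt t).mul (hasDerivAt_weight hq t)).congr_deriv (by
      rw [reduced_apply]
      ring)) (Continuous.intervalIntegrable (by fun_prop) _ _)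
  rw [hφ.2.eq, weight_eq_one hmean, weight_zero, sub_self, intervalIntegral.integral_sub,
    intervalIntegral.integral_add, intervalIntegral.integral_const_mul] at hint
  · linarith
  all_goals exact Continuous.intervalIntegrable (by fun_prop) _ _

theorem integral_weight_pos (hT : 0 < T) {q : ℝ → ℝ} (hq : Continuous q) :
    0 < ∫ t in (0 : ℝ)..T, weight q t :=
  intervalIntegral.intervalIntegral_pos_of_pos
    ((continuous_weight hq).intervalIntegrable _ _) (weight_pos q) hT

theorem le_muUpper (hT : 0 < T) (hγ : Continuous γ)
    (hφ : IsPeriodicSolution (reduced (centered T γ) lam) T φ) {q : ℝ → ℝ} (hq : q ∈ C1T0 T) :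
    lam ≤ muUpper T γ q := by
  have hqc := hq.1.1.continuous
  have hpos := integral_weight_pos hT hqc
  rw [muUpper, weighted_identity hγ hφ hqc ((average_eq_zero_iff hT q).1 hq.2), mul_add,
    mul_left_comm, inv_mul_cancel₀ hpos.ne', mul_one]
  have : 0 ≤ ∫ t in (0 : ℝ)..T, weight q t * (φ t - q t) ^ 2 :=
    intervalIntegral.integral_nonneg hT.le fun t _ =>
      mul_nonneg (weight_pos q t).le (sq_nonneg _)
  have := mul_nonneg (inv_nonneg.2 hpos.le) this
  linarith

theorem muUpper_of_periodic (hT : 0 < T) (hγ : Continuous γ)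
    (hφ : IsPeriodicSolution (reduced (centered T γ) lam) T φ)
    (hmean : ∫ t in (0 : ℝ)..T, φ t = 0) : muUpper T γ φ = lam := by
  have hpos := integral_weight_pos hT hφ.continuous
  rw [muUpper, weighted_identity hγ hφ hφ.continuous hmean]
  simp only [sub_self, ne_eq, OfNat.ofNat_ne_zero, not_false_eq_true, zero_pow, mul_zero,
    intervalIntegral.integral_zero, zero_add]
  rw [mul_left_comm, inv_mul_cancel₀ hpos.ne', mul_one]

theorem isGreatest_muLower (hT : 0 < T) (hγ : Continuous γ)
    (hφ : IsPeriodicSolution (reduced (centered T γ) lam) T φ)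
    (hmean : ∫ t in (0 : ℝ)..T, φ t = 0) : IsGreatest (muLower T γ '' C1T T) lam := by
  refine ⟨⟨φ, mem_C1T_of_reduced (hγ.sub continuous_const) hφ, muLower_of_periodic hT hφ⟩, ?_⟩
  rintro _ ⟨p, hp, rfl⟩
  exact muLower_le hT hγ hφ hmean hp

theorem isLeast_muUpper (hT : 0 < T) (hγ : Continuous γ)
    (hφ : IsPeriodicSolution (reduced (centered T γ) lam) T φ)
    (hmean : ∫ t in (0 : ℝ)..T, φ t = 0) : IsLeast (muUpper T γ '' C1T0 T) lam := by
  refine ⟨⟨φ, ⟨mem_C1T_of_reduced (hγ.sub continuous_const) hφ,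
    (average_eq_zero_iff hT φ).2 hmean⟩, muUpper_of_periodic hT hγ hφ hmean⟩, ?_⟩
  rintro _ ⟨q, hq, rfl⟩
  exact le_muUpper hT hγ hφ hq

theorem gammaStar_eq (hT : 0 < T) (hγ : Continuous γ)
    (hφ : IsPeriodicSolution (reduced (centered T γ) lam) T φ)
    (hmean : ∫ t in (0 : ℝ)..T, φ t = 0) : gammaStar T γ = lam :=
  (isGreatest_muLower hT hγ hφ hmean).csSup_eq

end Characterization

/-! ### Reduction of the general equation -/

section Reduction

variable {T : ℝ} {a₂ a₁ a₀ : ℝ → ℝ}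

theorem contDiff_shift (ha₂ : ContDiff ℝ ∞ a₂) (ha₁ : ContDiff ℝ ∞ a₁) (hne : ∀ t, a₂ t ≠ 0) :
    ContDiff ℝ ∞ (shift a₂ a₁) :=
  contDiff_const.mul (ha₁.add ((contDiff_infty_iff_deriv.1 ha₂).2.div ha₂ hne))

theorem continuous_reducedGamma (ha₂ : ContDiff ℝ ∞ a₂) (ha₁ : ContDiff ℝ ∞ a₁)
    (ha₀ : ContDiff ℝ ∞ a₀) (hne : ∀ t, a₂ t ≠ 0) : Continuous (reducedGamma a₂ a₁ a₀) := by
  have h := contDiff_shift ha₂ ha₁ hne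
  exact ((ha₂.continuous.mul ha₀.continuous).sub (h.continuous.pow 2)).add
    (contDiff_infty_iff_deriv.1 h).2.continuous

theorem periodic_deriv {a : ℝ → ℝ} (h : Function.Periodic a T) :
    Function.Periodic (deriv a) T := fun t => by
  rw [← deriv_comp_add_const, show (fun x => a (x + T)) = a from funext h]

theorem periodic_shift (hp₂ : Function.Periodic a₂ T) (hp₁ : Function.Periodic a₁ T) :
    Function.Periodic (shift a₂ a₁) T := fun t => by
  simp only [shift, hp₂ t, hp₁ t, periodic_deriv hp₂ t]

theorem periodic_reducedGamma (hp₂ : Function.Periodic a₂ T) (hp₁ : Function.Periodic a₁ T)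
    (hp₀ : Function.Periodic a₀ T) : Function.Periodic (reducedGamma a₂ a₁ a₀) T := fun t => by
  simp only [reducedGamma, hp₂ t, hp₀ t, periodic_shift hp₂ hp₁ t,
    periodic_deriv (periodic_shift hp₂ hp₁) t]

/-- Scaling by `a₂` makes the leading coefficient `1`, and the shift completes the square. -/
theorem reduced_of_riccati (ha₂ : ContDiff ℝ ∞ a₂) (ha₁ : ContDiff ℝ ∞ a₁)
    (hp₂ : Function.Periodic a₂ T) (hp₁ : Function.Periodic a₁ T) (hne : ∀ t, a₂ t ≠ 0)
    {x : ℝ → ℝ} (hx : IsPeriodicSolution (riccati a₂ a₁ a₀) T x) :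
    IsPeriodicSolution (reduced (centered T (reducedGamma a₂ a₁ a₀))
      (average T (reducedGamma a₂ a₁ a₀))) T (fun t => a₂ t * x t + shift a₂ a₁ t) := by
  refine ⟨fun t _ => ?_, fun t => by simp only [hp₂ t, hx.2 t, periodic_shift hp₂ hp₁ t]⟩
  have h2 := (ha₂.differentiable (by simp) t).hasDerivAt
  have hs := ((contDiff_shift ha₂ ha₁ hne).differentiable (by simp) t).hasDerivAt
  refine ((h2.mul (hx.hasDerivAt t)).add hs).hasDerivWithinAt.congr_deriv ?_
  rw [reduced_apply, centered, reducedGamma]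
  have hA : a₁ t * a₂ t = 2 * shift a₂ a₁ t * a₂ t - deriv a₂ t := by
    have := hne t
    simp only [shift]
    field_simp
    ring
  simp only [riccati]
  linear_combination (x t) * hA

theorem riccati_of_reduced (ha₂ : ContDiff ℝ ∞ a₂) (ha₁ : ContDiff ℝ ∞ a₁)
    (hp₂ : Function.Periodic a₂ T) (hp₁ : Function.Periodic a₁ T) (hne : ∀ t, a₂ t ≠ 0)
    {y : ℝ → ℝ} (hy : IsPeriodicSolution (reduced (centered T (reducedGamma a₂ a₁ a₀))
      (average T (reducedGamma a₂ a₁ a₀))) T y) :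
    IsPeriodicSolution (riccati a₂ a₁ a₀) T (fun t => (y t - shift a₂ a₁ t) / a₂ t) := by
  refine ⟨fun t _ => ?_, fun t => by simp only [hp₂ t, hy.2 t, periodic_shift hp₂ hp₁ t]⟩
  have h2 := (ha₂.differentiable (by simp) t).hasDerivAt
  have hs := ((contDiff_shift ha₂ ha₁ hne).differentiable (by simp) t).hasDerivAt
  refine (((hy.hasDerivAt t).sub hs).div h2 (hne t)).hasDerivWithinAt.congr_deriv ?_
  rw [reduced_apply, centered, reducedGamma]
  have hA : a₁ t = 2 * shift a₂ a₁ t - deriv a₂ t / a₂ t := by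
    simp only [shift]
    ring
  have := hne t
  simp only [riccati, hA, Pi.sub_apply]
  field_simp
  ring

/-- The multiplier of a periodic solution in terms of the mean of the reduced solution. -/
theorem variation_eq_one_iff (ha₂ : ContDiff ℝ ∞ a₂)
    (hp₂ : Function.Periodic a₂ T) (hne : ∀ t, a₂ t ≠ 0) {y : ℝ → ℝ} (hy : Continuous y) :
    variation a₂ a₁ (fun t => (y t - shift a₂ a₁ t) / a₂ t) T = 1 ↔
      ∫ t in (0 : ℝ)..T, y t = 0 := by
  have hd : Continuous (deriv a₂) := (contDiff_infty_iff_deriv.1 ha₂).2.continuous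
  have hq : Continuous fun t => deriv a₂ t / a₂ t := hd.div ha₂.continuous hne
  -- `Real.log` is the logarithm of the absolute value, so negative `a₂` is covered too.
  have hlog : ∫ t in (0 : ℝ)..T, deriv a₂ t / a₂ t = 0 := by
    rw [intervalIntegral.integral_eq_sub_of_hasDerivAt (f := fun t => Real.log (a₂ t))
      (fun t _ => (ha₂.differentiable (by simp) t).hasDerivAt.log (hne t))
      (hq.intervalIntegrable _ _), hp₂.eq, sub_self]
  have hfun : (fun t => 2 * a₂ t * ((y t - shift a₂ a₁ t) / a₂ t) + a₁ t) =
      fun t => 2 * y t - deriv a₂ t / a₂ t := funext fun t => by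
    have := hne t
    simp only [shift]
    field_simp
    ring
  rw [variation, Real.exp_eq_one_iff, hfun, intervalIntegral.integral_sub
    ((hy.const_mul 2).intervalIntegrable _ _)
    (hq.intervalIntegrable _ _), hlog,
    intervalIntegral.integral_const_mul]
  simp

end Reduction

end PeriodicRiccati

end

/-! ### Assembly of the three cases. -/

theorem mainTheorem4 (T : ℝ) (hT : 0 < T) (a₂ a₁ a₀ : ℝ → ℝ)
    (ha₂ : ContDiff ℝ ∞ a₂) (ha₁ : ContDiff ℝ ∞ a₁) (ha₀ : ContDiff ℝ ∞ a₀)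
    (hp₂ : Function.Periodic a₂ T) (hp₁ : Function.Periodic a₁ T)
    (hp₀ : Function.Periodic a₀ T) (hne : ∀ t, a₂ t ≠ 0)
    (γ : ℝ → ℝ) (hγ : γ = PeriodicRiccati.reducedGamma a₂ a₁ a₀)
    (f : ℝ → ℝ → ℝ) (hf : f = PeriodicRiccati.riccati a₂ a₁ a₀) :
    -- the number entering the discriminant is a maximum, and also a minimum
    (IsGreatest (PeriodicRiccati.muLower T γ '' PeriodicRiccati.C1T T)
        (PeriodicRiccati.gammaStar T γ) ∧
      IsLeast (PeriodicRiccati.muUpper T γ '' PeriodicRiccati.C1T0 T)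
        (PeriodicRiccati.gammaStar T γ)) ∧
    -- positive discriminant: exactly two periodic solutions, both hyperbolic limit cycles
    (0 < PeriodicRiccati.discriminant T γ →
      ∃ φ₁ φ₂ : ℝ → ℝ, φ₁ ≠ φ₂ ∧ {φ | PeriodicRiccati.IsPeriodicSolution f T φ} = {φ₁, φ₂} ∧
        PeriodicRiccati.IsHyperbolicLimitCycle f T φ₁ ∧
        PeriodicRiccati.IsHyperbolicLimitCycle f T φ₂) ∧
    -- zero discriminant: exactly one periodic solution, a semi-stable double limit cycle
    (PeriodicRiccati.discriminant T γ = 0 →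
      ∃ φ : ℝ → ℝ, {ψ | PeriodicRiccati.IsPeriodicSolution f T ψ} = {φ} ∧
        PeriodicRiccati.IsDoubleLimitCycle f T φ ∧ PeriodicRiccati.IsSemiStable f φ) ∧
    -- negative discriminant: no periodic solution
    (PeriodicRiccati.discriminant T γ < 0 →
      {φ | PeriodicRiccati.IsPeriodicSolution f T φ} = ∅) ∧
    -- bounds for the discriminant
    (∀ p ∈ PeriodicRiccati.C1T T, ∀ q ∈ PeriodicRiccati.C1T0 T,
      PeriodicRiccati.muLower T γ p - PeriodicRiccati.average T γ
          ≤ PeriodicRiccati.discriminant T γ ∧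
        PeriodicRiccati.discriminant T γ
          ≤ PeriodicRiccati.muUpper T γ q - PeriodicRiccati.average T γ) := by
  have hγc : Continuous γ := hγ ▸ PeriodicRiccati.continuous_reducedGamma ha₂ ha₁ ha₀ hne
  have hγp : Function.Periodic γ T := hγ ▸ PeriodicRiccati.periodic_reducedGamma hp₂ hp₁ hp₀
  have hgc : Continuous (PeriodicRiccati.centered T γ) := hγc.sub continuous_const
  have hgp : Function.Periodic (PeriodicRiccati.centered T γ) T := fun t => by
    simp only [PeriodicRiccati.centered, hγp t]
  obtain ⟨lam, φ, hφ, hmean⟩ := PeriodicRiccati.exists_zero_mean_periodic hT hgc hgp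
  have hstar := PeriodicRiccati.gammaStar_eq hT hγc hφ hmean
  have hgreat := PeriodicRiccati.isGreatest_muLower hT hγc hφ hmean
  have hleast := PeriodicRiccati.isLeast_muUpper hT hγc hφ hmean
  simp only [PeriodicRiccati.discriminant, hstar]
  refine ⟨⟨hgreat, hleast⟩, fun hpos => ?_, fun hzero => ?_, fun hneg => ?_, fun p hp q hq =>
    ⟨sub_le_sub_right (hgreat.2 ⟨p, hp, rfl⟩) _, sub_le_sub_right (hleast.2 ⟨q, hq, rfl⟩) _⟩⟩
  -- Since the average lies below `lam`, the extremal solution `φ` is itself a strict upper solution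
  -- at the average.
  · obtain ⟨y, hy⟩ := PeriodicRiccati.exists_periodic_of_upper_solution
      (lam := PeriodicRiccati.average T γ) hT hgc hgp hφ.hasDerivAt hφ.2 fun t => by
        rw [PeriodicRiccati.reduced_apply]
        linarith
    -- A zero-mean solution at this parameter would identify `γ^*` with the average.
    have hymean : ∫ t in (0 : ℝ)..T, y t ≠ 0 := fun h => by
      have := PeriodicRiccati.gammaStar_eq hT hγc hy h
      linarith
    subst hγ hf
    have hm := (PeriodicRiccati.variation_eq_one_iff (a₁ := a₁) ha₂ hp₂ hne hy.continuous).not.2 hymean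
    exact ⟨_, PeriodicRiccati.two_hyperbolic_of_variation_ne_one ha₂.continuous ha₁.continuous
      ha₀.continuous hp₂ hp₁ hp₀ hne hT
      (PeriodicRiccati.riccati_of_reduced ha₂ ha₁ hp₂ hp₁ hne hy) hm⟩
  · rw [sub_eq_zero.1 hzero] at hφ
    subst hγ hf
    have hx := PeriodicRiccati.riccati_of_reduced ha₂ ha₁ hp₂ hp₁ hne hφ
    have hm := (PeriodicRiccati.variation_eq_one_iff (a₁ := a₁) ha₂ hp₂ hne hφ.continuous).2 hmean
    obtain ⟨h1, h2⟩ := PeriodicRiccati.unique_double_of_variation_eq_one ha₂.continuous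
      ha₁.continuous hne hT hx hm
    exact ⟨_, h1, h2, PeriodicRiccati.isSemiStable_of_variation_eq_one ha₂.continuous
      ha₁.continuous hp₂ hp₁ hne hT hx hm⟩
  · subst hγ hf
    refine Set.eq_empty_iff_forall_notMem.2 fun x hx => ?_
    have hy := PeriodicRiccati.reduced_of_riccati ha₂ ha₁ hp₂ hp₁ hne hx
    have h1 := PeriodicRiccati.muLower_of_periodic hT hy
    have h2 := hgreat.2 ⟨_, PeriodicRiccati.mem_C1T_of_reduced hgc hy, h1⟩
    linarith
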